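/- \textbf{Theorem (Strong convergence of 1RDSA).} Let $f:\mathbb R^N\to\mathbb R$, let $\|\cdot\|$ be the Euclidean norm, and let $(a_n)_{n\ge0}$, $(\delta_n)_{n\ge0}$ be real sequences. On a probability space let $x_0$ and $d_n=(d_n^1,\dots,d_n^N)$, $n\ge 0$, be $\mathbb R^N$-valued random vectors and $\xi_n^+,\xi_n^-$, $n\ge0$, real random variables. Put $y_n^{\pm}=f(x_n\pm\delta_n d_n)+\xi_n^{\pm}$ and let $$x_{n+1}=x_n-a_n\widehat\nabla f(x_n),\qquad n\ge 0,$$ where one of the following two choices is made for all $n$: \begin{itemize} \item (uniform perturbations) for some $\eta>0$, each $d_n^i$ is uniformly distributed on $[-\eta,\eta]$, and $\widehat\nabla f(x_n)=\frac{3}{\eta^2}\,d_n\,\frac{y_n^+-y_n^-}{2\delta_n}$; or \item (asymmetric Bernoulli perturbations) for some $\epsilon>0$, each $d_n^i$ equals $-1$ with probability $\frac{1+\epsilon}{2+\epsilon}$ and $1+\epsilon$ with probability $\frac1{2+\epsilon}$, and $\widehat\nabla f(x_n)=\frac{1}{1+\epsilon}\,d_n\,\frac{y_n^+-y_n^-}{2\delta_n}$.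 \end{itemize} Let $\mathcal F_n=\sigma(x_m, m\le n)$, and assume: \begin{itemize} \item[(A1)] $f$ is three times continuously differentiable and there is $\alpha_0<\infty$ such that $|\nabla^3_{i_1i_2i_3}f(x)|<\alpha_0$ for all $i_1,i_2,i_3\in\{1,\dots,N\}$ and all $x\in\mathbb R^N$. \item[(A2)] $\mathbb E[\xi_n^+-\xi_n^-\mid d_n,\mathcal F_n]=0$ almost surely, for all $n$. \item[(A3)] There are $\alpha_1,\alpha_2,\zeta>0$ such that $\mathbb E|\xi_n^{\pm}|^{2+\zeta}\le\alpha_1$ and $\mathbb E|f(x_n\pm\delta_nd_n)|^{2+\zeta}\le\alpha_2$ for all $n$. \item[(A4)] The random variables $d_n^i$ ($1\le i\le N$, $n\ge0$) are i.i.d., and for each $n$ the vector $d_n$ is independent of $\mathcal F_n$. \item[(A5)] $a_n>0$ and $\delta_n>0$ for all $n$, $a_n\to0$, $\delta_n\to0$, $\sum_n a_n=\infty$ and $\sum_n (a_n/\delta_n)^2<\infty$. \item[(A6)] $\sup_n\|x_n\|<\infty$ almost surely. \end{itemize} Let $x^*$ be an asymptotically stable equilibrium of the ODE $\dot x=-\nabla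 f(x)$; that is, $\nabla f(x^*)=0$, $x^*$ is Lyapunov stable, and the domain of attraction $D(x^*)$ contains a neighbourhood of $x^*$, where $D(x^*)$ is the set of all initial points from which the solution of the ODE exists on $[0,\infty)$ and converges to $x^*$ as $t\to\infty$. Suppose that there is a (non-random) compact set $\mathcal D\subseteq D(x^*)$ such that, almost surely, $x_n\in\mathcal D$ for infinitely many $n$. Then $x_n\to x^*$ almost surely as $n\to\infty$. -/

import Mathlib

open MeasureTheory ProbabilityTheory Filter Topology

noncomputable section

namespace RDSA

/-- `ℝ^N` with its Euclidean norm. -/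
abbrev Vec (N : ℕ) : Type := EuclideanSpace ℝ (Fin N)

/-! ### The gradient flow and stability of its equilibria -/

/-- `γ` is a solution on `[0, ∞)` of the ODE `ẋ = -∇f(x)`. -/
def IsGradientFlow {N : ℕ} (f : Vec N → ℝ) (γ : ℝ → Vec N) : Prop :=
  IsIntegralCurveOn γ (fun _ x => -gradient f x) (Set.Ici 0)

/-- The domain of attraction of `xs`: all initial points from which the ODE `ẋ = -∇f(x)` has a
solution on `[0, ∞)` that converges to `xs`. (For `f` of class `C²` the solution with a given
initial point is unique.) -/
def domainOfAttraction {N : ℕ} (f : Vec N → ℝ) (xs : Vec N) : Set (Vec N) :=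
  {x₀ | ∃ γ : ℝ → Vec N, IsGradientFlow f γ ∧ γ 0 = x₀ ∧ Tendsto γ atTop (𝓝 xs)}

/-- `xs` is an asymptotically stable equilibrium of `ẋ = -∇f(x)`: it is an equilibrium, it is
Lyapunov stable, and it attracts all solutions that start near it. -/
structure IsAsymptoticallyStable {N : ℕ} (f : Vec N → ℝ) (xs : Vec N) : Prop where
  equilibrium : gradient f xs = 0
  stable : ∀ ε > 0, ∃ r > 0, ∀ γ : ℝ → Vec N, IsGradientFlow f γ → dist (γ 0) xs < r →
    ∀ t, 0 ≤ t → dist (γ t) xs < ε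
  attracting : ∃ r > 0, Metric.ball xs r ⊆ domainOfAttraction f xs

/-! ### Perturbations, gradient estimate and iterates -/

/-- The two kinds of random perturbation: uniform on `[-η, η]`, and asymmetric Bernoulli with
parameter `ε`. -/
inductive Perturbation : Type where
  | uniform (η : ℝ) (hη : 0 < η)
  | asymBernoulli (ε : ℝ) (hε : 0 < ε)

/-- The common law of the coordinates `d_n^i`. -/
def Perturbation.law : Perturbation → Measure ℝ
  | .uniform η _ => ProbabilityTheory.cond volume (Set.Icc (-η) η)
  | .asymBernoulli ε _ =>
      ENNReal.ofReal ((1 + ε) / (2 + ε)) • Measure.dirac (-1) +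
        ENNReal.ofReal (1 / (2 + ε)) • Measure.dirac (1 + ε)

/-- The scaling factor of the gradient estimate: `3/η²` or `1/(1+ε)`. -/
def Perturbation.scale : Perturbation → ℝ
  | .uniform η _ => 3 / η ^ 2
  | .asymBernoulli ε _ => 1 / (1 + ε)

/-- The gradient estimate at `x` with perturbation constant `δ`, perturbation vector `d`, and
measurement noises `ξp`, `ξm`. -/
def gradEstimate {N : ℕ} (p : Perturbation) (f : Vec N → ℝ) (δ : ℝ) (x d : Vec N)
    (ξp ξm : ℝ) : Vec N :=
  (p.scale * (((f (x + δ • d) + ξp) - (f (x - δ • d) + ξm)) / (2 * δ))) • d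

/-- The 1RDSA iterates `x_{n+1} = x_n - a_n ∇̂f(x_n)`, started at the random vector `x₀`. -/
def iterate {N : ℕ} {Ω : Type*} (p : Perturbation) (f : Vec N → ℝ) (a δ : ℕ → ℝ)
    (d : ℕ → Ω → Vec N) (ξp ξm : ℕ → Ω → ℝ) (x₀ : Ω → Vec N) : ℕ → Ω → Vec N
  | 0, ω => x₀ ω
  | n + 1, ω =>
      iterate p f a δ d ξp ξm x₀ n ω -
        a n • gradEstimate p f (δ n) (iterate p f a δ d ξp ξm x₀ n ω) (d n ω) (ξp n ω) (ξm n ω)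

/-- The σ-field `F_n = σ(x_m, m ≤ n)`. -/
abbrev history {N : ℕ} {Ω : Type*} (x : ℕ → Ω → Vec N) (n : ℕ) : MeasurableSpace Ω :=
  ⨆ m ≤ n, MeasurableSpace.comap (x m) inferInstance

/-- The entry `∇³_{i j k} f(x)` of the third derivative of `f` at `x`. -/
def thirdPartial {N : ℕ} (f : Vec N → ℝ) (i j k : Fin N) (x : Vec N) : ℝ :=
  iteratedFDeriv ℝ 3 f x
    ![EuclideanSpace.single i 1, EuclideanSpace.single j 1, EuclideanSpace.single k 1]

end RDSA

end

namespace RDSA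

/-! ### Euler schemes and integral curves -/

/-! The iteration is a noisy Euler scheme for the gradient flow: the step direction is `∇f(x_n) +
b_n + m_n`, where `b_n` is the conditional mean of the estimate minus the gradient, and `m_n` is a
martingale difference. Since the coordinates of `d_n` are centred, independent and of variance `1 /
p.scale`, the linearised estimate has mean exactly `∇f(x_n)`; the linearisation error is `O(δ_n)`
along a bounded trajectory, so `b_n → 0`. The estimate has second moment `O(1/δ_n²)`, so `∑
(a_n/δ_n)² < ∞` makes the martingale `∑ a_n m_n` bounded in `L²` and hence almost surely convergent.

What remains is deterministic, one trajectory at a time (`tendsto_of_convergent_noise`). Subtracting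
the tail of the noise series leaves a bounded Euler scheme whose errors tend to zero. Recurrence to
a compact subset of the domain of attraction gives a cluster point there. By Gronwall the scheme
shadows the flow over finite time, so cluster points are carried along flow lines
(`mapClusterPt_integralCurve`); their set is closed, so the equilibrium is itself a cluster point.

To pass from cluster point to limit, `f` serves as a Lyapunov function. It decreases along the flow,
so on a ball inside the domain of attraction the equilibrium is a strict minimum and the only
critical point. A small sublevel set around it then traps every late iterate that enters it
(`tendsto_of_mapClusterPt_of_strict_min`). -/

theorem discrete_gronwall {u a : ℕ → ℝ} {L ε : ℝ} (hL : 0 ≤ L) (hε : 0 ≤ ε) (ha : ∀ n, 0 ≤ a n)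
    (hu0 : 0 ≤ u 0) (hu : ∀ n, u (n + 1) ≤ (1 + L * a n) * u n + a n * ε) (n : ℕ) :
    u n ≤ Real.exp (L * ∑ k ∈ Finset.range n, a k) *
      (u 0 + ε * ∑ k ∈ Finset.range n, a k) := by
  induction n with
  | zero => simp
  | succ n ih =>
    rw [Finset.sum_range_succ]
    set s := ∑ k ∈ Finset.range n, a k with hs
    have hs0 : 0 ≤ s := Finset.sum_nonneg fun k _ => ha k
    have hLa : 0 ≤ L * a n := mul_nonneg hL (ha n)
    have h1 : 1 + L * a n ≤ Real.exp (L * a n) := by linarith [Real.add_one_le_exp (L * a n)]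
    have h2 : 1 ≤ Real.exp (L * (s + a n)) :=
      Real.one_le_exp (mul_nonneg hL (add_nonneg hs0 (ha n)))
    have h3 : 0 ≤ u 0 + ε * s := by positivity
    calc u (n + 1) ≤ (1 + L * a n) * u n + a n * ε := hu n
      _ ≤ (1 + L * a n) * (Real.exp (L * s) * (u 0 + ε * s)) + 1 * (a n * ε) := by
          rw [one_mul]; gcongr
      _ ≤ Real.exp (L * a n) * (Real.exp (L * s) * (u 0 + ε * s))
            + Real.exp (L * (s + a n)) * (a n * ε) := by
          have := ha n
          gcongr
      _ = Real.exp (L * (s + a n)) * (u 0 + ε * (s + a n)) := by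
          rw [mul_add L s, Real.exp_add]; ring

section Normed

variable {E : Type*} [NormedAddCommGroup E] [NormedSpace ℝ E]

theorem norm_integralCurve_sub_le {g : E → E} {γ : ℝ → E} {B : ℝ}
    (hγ : IsIntegralCurveOn γ (fun _ x => -g x) (Set.Ici 0))
    (hB : ∀ t, 0 ≤ t → ‖g (γ t)‖ ≤ B) {s t : ℝ} (hs : 0 ≤ s) (ht : 0 ≤ t) :
    ‖γ t - γ s‖ ≤ B * |t - s| := by
  have := Convex.norm_image_sub_le_of_norm_hasDerivWithin_le (f := γ) (s := Set.Ici 0)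
    (fun x hx => hγ x hx) (C := B) (fun x hx => by simpa using hB x hx) (convex_Ici 0) hs ht
  simpa using this

/-- Local truncation error of the Euler method. The curve minus its tangent line at `t` has
derivative `g (γ t) - g (γ s)`, of norm at most `L * B * h` on the interval, and the mean value
inequality supplies the other factor `h`. -/
theorem norm_integralCurve_euler_le {g : E → E} {γ : ℝ → E} {B L R : ℝ} (hL : 0 ≤ L)
    (hγ : IsIntegralCurveOn γ (fun _ x => -g x) (Set.Ici 0))
    (hR : ∀ t, 0 ≤ t → ‖γ t‖ ≤ R)
    (hB : ∀ t, 0 ≤ t → ‖g (γ t)‖ ≤ B)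
    (hLip : ∀ x y, ‖x‖ ≤ R → ‖y‖ ≤ R → ‖g x - g y‖ ≤ L * ‖x - y‖)
    {t h : ℝ} (ht : 0 ≤ t) (hh : 0 ≤ h) :
    ‖γ (t + h) - γ t + h • g (γ t)‖ ≤ h * (L * B * h) := by
  have hB0 : 0 ≤ B := (norm_nonneg _).trans (hB 0 le_rfl)
  have := Convex.norm_image_sub_le_of_norm_hasDerivWithin_le
    (f := fun s => γ s + (s - t) • g (γ t)) (f' := fun s => -g (γ s) + g (γ t))
    (s := Set.Icc t (t + h)) (x := t) (y := t + h) (C := L * B * h)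
    (fun s hs => ?_) (fun s hs => ?_) (convex_Icc _ _) (by simp [hh]) (by simp [hh])
  · simp only [add_sub_cancel_left, sub_self, zero_smul, add_zero, Real.norm_eq_abs,
      abs_of_nonneg hh] at this
    rw [mul_comm h]
    convert this using 2
    abel
  · have h1 := (hγ s (ht.trans hs.1)).mono (s := Set.Icc t (t + h))
      (fun r hr => ht.trans hr.1)
    have h2 : HasDerivWithinAt (fun s : ℝ => (s - t) • g (γ t)) (g (γ t)) (Set.Icc t (t + h)) s := by
      simpa using (((hasDerivAt_id s).sub_const t).smul_const (g (γ t))).hasDerivWithinAt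
    exact h1.add h2
  · have hs0 : 0 ≤ s := ht.trans hs.1
    calc ‖-g (γ s) + g (γ t)‖ = ‖g (γ t) - g (γ s)‖ := by congr 1; abel
      _ ≤ L * ‖γ t - γ s‖ := hLip _ _ (hR t ht) (hR s hs0)
      _ ≤ L * (B * |t - s|) := by gcongr; exact norm_integralCurve_sub_le hγ hB hs0 ht
      _ ≤ L * (B * h) := by
          gcongr
          rw [abs_le]; constructor <;> linarith [hs.1, hs.2]
      _ = L * B * h := by ring

/-- The cluster points of a bounded perturbed Euler scheme are forward invariant under the
differential equation. -/
theorem mapClusterPt_integralCurve {g : E → E} {γ : ℝ → E} {L R : ℝ} (hL : 0 ≤ L)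
    (hLip : ∀ x y, ‖x‖ ≤ R → ‖y‖ ≤ R → ‖g x - g y‖ ≤ L * ‖x - y‖)
    {a : ℕ → ℝ} (ha_pos : ∀ n, 0 ≤ a n) (ha : Tendsto a atTop (𝓝 0))
    (ha_sum : Tendsto (fun n => ∑ k ∈ Finset.range n, a k) atTop atTop)
    {z e : ℕ → E} (hz : ∀ n, z (n + 1) = z n - a n • (g (z n) + e n))
    (he : Tendsto e atTop (𝓝 0)) (hzR : ∀ n, ‖z n‖ ≤ R)
    (hγ : IsIntegralCurveOn γ (fun _ x => -g x) (Set.Ici 0))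
    (hγR : ∀ t, 0 ≤ t → ‖γ t‖ ≤ R)
    (hcl : MapClusterPt (γ 0) atTop z) {t : ℝ} (ht : 0 ≤ t) :
    MapClusterPt (γ t) atTop z := by
  obtain ⟨B, hB⟩ : ∃ B, ∀ x, ‖x‖ ≤ R → ‖g x‖ ≤ B := by
    have hR0 : 0 ≤ R := (norm_nonneg _).trans (hzR 0)
    refine ⟨‖g 0‖ + L * R, fun x hx => ?_⟩
    have h1 := hLip x 0 hx (by simpa using hR0)
    have h2 : ‖g x‖ ≤ ‖g x - g 0‖ + ‖g 0‖ := by simpa using norm_add_le (g x - g 0) (g 0)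
    rw [sub_zero] at h1
    nlinarith
  have hB0 : 0 ≤ B := (norm_nonneg _).trans (hB _ (hzR 0))
  have hBγ : ∀ t, 0 ≤ t → ‖g (γ t)‖ ≤ B := fun t ht => hB _ (hγR t ht)
  rw [mapClusterPt_iff_frequently]
  intro U hU
  obtain ⟨ε, hε, hεU⟩ := Metric.mem_nhds_iff.1 hU
  -- The total error at time `t` will come out as `ε₁ * C`: the Gronwall factor times initial error
  -- and accumulated defect, plus one `ε₁` for rounding `t` to the time grid.
  set C := Real.exp (L * t) * (1 + t) + 1 with hC
  have hC0 : 0 < C := by positivity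
  set ε₁ := ε / (2 * C) with hε₁
  have hε₁0 : 0 < ε₁ := by positivity
  have hεC : ε₁ * C < ε := by
    rw [hε₁]; field_simp; linarith
  -- Defect per unit time of one step: the perturbation plus the Euler truncation error.
  have hev : ∀ᶠ n in atTop, ‖e n‖ + L * B * a n < ε₁ := by
    have : Tendsto (fun n => ‖e n‖ + L * B * a n) atTop (𝓝 0) := by
      simpa using he.norm.add (ha.const_mul (L * B))
    exact this.eventually (gt_mem_nhds hε₁0)
  have hev' : ∀ᶠ n in atTop, B * a n < ε₁ := by
    have : Tendsto (fun n => B * a n) atTop (𝓝 0) := by simpa using ha.const_mul B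
    exact this.eventually (gt_mem_nhds hε₁0)
  obtain ⟨n₁, hn₁⟩ := eventually_atTop.1 (hev.and hev')
  rw [frequently_atTop]
  intro n₀
  obtain ⟨n, hn, hnz⟩ := frequently_atTop.1
    (mapClusterPt_iff_frequently.1 hcl _ (Metric.ball_mem_nhds _ hε₁0)) (max n₀ n₁)
  have hn0 : n₀ ≤ n := (le_max_left _ _).trans hn
  have hn1 : n₁ ≤ n := (le_max_right _ _).trans hn
  -- Flow time elapsed in the `k` steps after index `n`, at which `z n` is close to `γ 0`.
  set s : ℕ → ℝ := fun k => ∑ j ∈ Finset.range k, a (n + j) with hs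
  have hs0 : ∀ k, 0 ≤ s k := fun k => Finset.sum_nonneg fun j _ => ha_pos _
  have hs_succ : ∀ k, s (k + 1) = s k + a (n + k) := fun k => Finset.sum_range_succ _ _
  have hgr : ∀ k, ‖z (n + k) - γ (s k)‖ ≤ Real.exp (L * s k) * (‖z n - γ 0‖ + ε₁ * s k) := by
    have := discrete_gronwall (u := fun k => ‖z (n + k) - γ (s k)‖) (a := fun k => a (n + k))
      hL hε₁0.le (fun k => ha_pos _) (norm_nonneg _) (fun k => ?_)
    · simpa [hs] using this
    · have e1 := norm_integralCurve_euler_le hL hγ hγR hBγ hLip (hs0 k) (ha_pos (n + k))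
      have e2 := hLip _ _ (hzR (n + k)) (hγR _ (hs0 k))
      have e3 := (hn₁ (n + k) (by omega)).1
      have hak := ha_pos (n + k)
      have e4 : z (n + (k + 1)) - γ (s (k + 1)) = (z (n + k) - γ (s k))
          - a (n + k) • (g (z (n + k)) - g (γ (s k))) - a (n + k) • e (n + k)
          - (γ (s k + a (n + k)) - γ (s k) + a (n + k) • g (γ (s k))) := by
        rw [hs_succ, ← add_assoc, hz]
        simp only [smul_add, smul_sub]
        abel
      rw [e4]
      refine (norm_sub_le _ _).trans ?_
      refine (add_le_add_left ((norm_sub_le _ _).trans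
        (add_le_add_left (norm_sub_le _ _) _)) _).trans ?_
      rw [norm_smul, norm_smul, Real.norm_eq_abs, abs_of_nonneg hak]
      nlinarith [mul_le_mul_of_nonneg_left e2 hak, mul_le_mul_of_nonneg_left e3.le hak]
  have hs_top : Tendsto s atTop atTop := by
    have h1 : ∀ k, s k = ∑ j ∈ Finset.range (k + n), a j - ∑ j ∈ Finset.range n, a j := by
      intro k
      rw [add_comm k n, Finset.sum_range_add]; simp [hs]
    simp_rw [funext h1, sub_eq_add_neg]
    exact tendsto_atTop_add_const_right _ _ ((tendsto_add_atTop_iff_nat n).2 ha_sum)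
  -- The last grid time not exceeding `t`; it exists because `s 0 = 0 ≤ t` and the step sizes have
  -- infinite sum.
  obtain ⟨k, hk1, hk2⟩ : ∃ k, s k ≤ t ∧ t < s (k + 1) := by
    have hex : ∃ k, t < s k := (hs_top.eventually_gt_atTop t).exists
    classical
    obtain ⟨k, hk⟩ : ∃ k, Nat.find hex = k + 1 := by
      refine Nat.exists_eq_succ_of_ne_zero fun h => ?_
      have := Nat.find_spec hex
      rw [h] at this
      simp [hs] at this
      linarith
    exact ⟨k, not_lt.1 (Nat.find_min hex (by omega)), hk ▸ Nat.find_spec hex⟩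
  refine ⟨n + k, by omega, hεU ?_⟩
  rw [Metric.mem_ball, dist_eq_norm]
  rw [mem_ball_iff_norm] at hnz
  have h1 : ‖γ t - γ (s k)‖ ≤ ε₁ := by
    refine (norm_integralCurve_sub_le hγ hBγ (hs0 k) ht).trans ?_
    rw [abs_of_nonneg (by linarith)]
    have := (hn₁ (n + k) (by omega)).2
    have h3 := hs_succ k
    nlinarith
  have hsk := hs0 k
  calc ‖z (n + k) - γ t‖ = ‖(z (n + k) - γ (s k)) - (γ t - γ (s k))‖ := by congr 1; abel
    _ ≤ ‖z (n + k) - γ (s k)‖ + ‖γ t - γ (s k)‖ := norm_sub_le _ _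
    _ ≤ Real.exp (L * s k) * (‖z n - γ 0‖ + ε₁ * s k) + ε₁ := add_le_add (hgr k) h1
    _ ≤ Real.exp (L * t) * (ε₁ + ε₁ * t) + ε₁ := by gcongr
    _ = ε₁ * C := by rw [hC]; ring
    _ < ε := hεC

end Normed

/-! ### The gradient of a smooth function -/

section Gradient

variable {N : ℕ} {f : Vec N → ℝ}

theorem contDiff_gradient (hf : ContDiff ℝ 2 f) : ContDiff ℝ 1 (gradient f) :=
  (InnerProductSpace.toDual ℝ (Vec N)).symm.contDiff.comp
    (hf.fderiv_right (m := 1) (by norm_num))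

theorem inner_gradient_eq (f : Vec N → ℝ) (x v : Vec N) :
    inner ℝ (gradient f x) v = fderiv ℝ f x v := by
  simp [gradient]

theorem norm_fderiv_sub (f : Vec N → ℝ) (x y : Vec N) :
    ‖fderiv ℝ f x - fderiv ℝ f y‖ = ‖gradient f x - gradient f y‖ := by
  simp only [gradient, ← map_sub, LinearIsometryEquiv.norm_map]

theorem exists_lipschitz_gradient (hf : ContDiff ℝ 2 f) (R : ℝ) :
    ∃ L : ℝ, 0 ≤ L ∧ ∀ x y, ‖x‖ ≤ R → ‖y‖ ≤ R →
      ‖gradient f x - gradient f y‖ ≤ L * ‖x - y‖ := by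
  obtain ⟨K, hK⟩ := ((contDiff_gradient hf).locallyLipschitz.locallyLipschitzOn
    (s := Metric.closedBall 0 R)).exists_lipschitzOnWith_of_compact (isCompact_closedBall _ _)
  refine ⟨K, K.2, fun x y hx hy => ?_⟩
  exact lipschitzOnWith_iff_norm_sub_le.1 hK (by simpa using hx) (by simpa using hy)

/-- Quadratic bound for the remainder of the first order expansion. -/
theorem abs_sub_sub_inner_le (hf : Differentiable ℝ f) {L R : ℝ}
    (hLip : ∀ x y, ‖x‖ ≤ R → ‖y‖ ≤ R → ‖gradient f x - gradient f y‖ ≤ L * ‖x - y‖) (hL : 0 ≤ L)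
    {x y : Vec N} (hx : ‖x‖ ≤ R) (hy : ‖y‖ ≤ R) :
    |f y - f x - inner ℝ (gradient f x) (y - x)| ≤ L * ‖y - x‖ ^ 2 := by
  have hseg : ∀ w ∈ segment ℝ x y, ‖w‖ ≤ R := fun w hw => by
    have := (convex_closedBall (0 : Vec N) R).segment_subset (by simpa using hx)
      (by simpa using hy) hw
    simpa using this
  have := Convex.norm_image_sub_le_of_norm_hasFDerivWithin_le' (𝕜 := ℝ) (f := f) (f' := fderiv ℝ f)
    (s := segment ℝ x y) (x := x) (y := y) (φ := fderiv ℝ f x) (C := L * ‖y - x‖)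
    (fun w _ => (hf w).hasFDerivAt.hasFDerivWithinAt) (fun w hw => ?_) (convex_segment _ _)
    (left_mem_segment _ _ _) (right_mem_segment _ _ _)
  · rw [inner_gradient_eq, ← Real.norm_eq_abs]
    linarith
  · rw [norm_fderiv_sub]
    refine (hLip _ _ (hseg w hw) hx).trans ?_
    gcongr
    exact norm_sub_le_of_mem_segment hw

end Gradient

/-! ### Gradient flow lines -/

section Flow

variable {N : ℕ} {f : Vec N → ℝ} {γ : ℝ → Vec N} {xs : Vec N}

theorem IsGradientFlow.continuousOn (hγ : IsGradientFlow f γ) : ContinuousOn γ (Set.Ici 0) :=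
  fun t ht => (hγ t ht).continuousWithinAt

theorem IsGradientFlow.exists_norm_le (hγ : IsGradientFlow f γ) (hlim : Tendsto γ atTop (𝓝 xs)) :
    ∃ R, ∀ t, 0 ≤ t → ‖γ t‖ ≤ R := by
  obtain ⟨T, hT⟩ := eventually_atTop.1 (hlim.norm.eventually (gt_mem_nhds (lt_add_one ‖xs‖)))
  obtain ⟨C, hC⟩ := (isCompact_Icc (a := (0 : ℝ)) (b := T)).exists_bound_of_continuousOn
    (hγ.continuousOn.mono Set.Icc_subset_Ici_self)
  refine ⟨max C (‖xs‖ + 1), fun t ht => ?_⟩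
  rcases le_total t T with h | h
  · exact (hC t ⟨ht, h⟩).trans (le_max_left _ _)
  · exact (hT t h).le.trans (le_max_right _ _)

theorem IsGradientFlow.hasDerivAt_comp (hf : Differentiable ℝ f) (hγ : IsGradientFlow f γ) {t : ℝ}
    (ht : 0 < t) : HasDerivAt (fun s => f (γ s)) (-‖gradient f (γ t)‖ ^ 2) t := by
  have h1 : HasDerivAt γ (-gradient f (γ t)) t := (hγ t ht.le).hasDerivAt (Ici_mem_nhds ht)
  have h2 := (hf (γ t)).hasFDerivAt.comp_hasDerivAt t h1
  rwa [← inner_gradient_eq, inner_neg_right, real_inner_self_eq_norm_sq] at h2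

theorem IsGradientFlow.antitoneOn (hf : Differentiable ℝ f) (hγ : IsGradientFlow f γ) :
    AntitoneOn (fun s => f (γ s)) (Set.Ici 0) := by
  refine antitoneOn_of_deriv_nonpos (convex_Ici 0) (hf.continuous.comp_continuousOn hγ.continuousOn)
    (fun t ht => ?_) (fun t ht => ?_)
  all_goals
    rw [interior_Ici] at ht
    have := hγ.hasDerivAt_comp hf ht
  · exact this.differentiableAt.differentiableWithinAt
  · rw [this.deriv]; simp

theorem le_of_mem_domainOfAttraction (hf : Differentiable ℝ f) {y : Vec N}
    (hy : y ∈ domainOfAttraction f xs) : f xs ≤ f y := by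
  obtain ⟨γ, hγ, rfl, hlim⟩ := hy
  refine le_of_tendsto ((hf.continuous.tendsto _).comp hlim) ?_
  filter_upwards [eventually_ge_atTop 0] with t ht
  exact hγ.antitoneOn hf (Set.mem_Ici.2 le_rfl) ht ht

/-- If the two values agreed, the nonincreasing function `f ∘ γ` would be constant, so the gradient
would vanish along `γ`. Then `γ` has zero speed and never leaves its starting point, which must be
its limit. -/
theorem lt_of_mem_domainOfAttraction (hf : ContDiff ℝ 2 f) {y : Vec N}
    (hy : y ∈ domainOfAttraction f xs) (hne : y ≠ xs) : f xs < f y := by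
  have hfd : Differentiable ℝ f := hf.differentiable (by norm_num)
  refine lt_of_le_of_ne (le_of_mem_domainOfAttraction hfd hy) fun heq => hne ?_
  obtain ⟨γ, hγ, rfl, hlim⟩ := hy
  have hconst : ∀ t, 0 ≤ t → f (γ t) = f (γ 0) := fun t ht => by
    refine le_antisymm (hγ.antitoneOn hfd (Set.mem_Ici.2 le_rfl) ht ht) ?_
    rw [← heq]
    refine le_of_tendsto ((hfd.continuous.tendsto _).comp hlim) ?_
    filter_upwards [eventually_ge_atTop t] with s hs
    exact hγ.antitoneOn hfd ht (ht.trans hs) hs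
  have hcrit : ∀ t, 0 < t → gradient f (γ t) = 0 := fun t ht => by
    have h1 : HasDerivAt (fun s => f (γ s)) 0 t :=
      (hasDerivAt_const t (f (γ 0))).congr_of_eventuallyEq
        (by filter_upwards [lt_mem_nhds ht] with s hs using hconst s hs.le)
    have := h1.unique (hγ.hasDerivAt_comp hfd ht)
    simpa using this.symm
  have hcrit' : ∀ t, 0 ≤ t → ‖gradient f (γ t)‖ ≤ 0 := fun t ht => by
    rcases ht.eq_or_lt with rfl | h
    -- At time `0` the derivative along the curve is only one-sided, so the gradient there is found
    -- by continuity from the right.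
    · have h1 : Tendsto (fun t => gradient f (γ t)) (𝓝[>] 0) (𝓝 (gradient f (γ 0))) :=
        (((contDiff_gradient hf).continuous.tendsto _).comp
          (hγ.continuousOn 0 (Set.mem_Ici.2 le_rfl))).mono_left
            (nhdsWithin_mono _ Set.Ioi_subset_Ici_self)
      have h2 : gradient f (γ 0) = 0 := tendsto_nhds_unique h1 (tendsto_const_nhds.congr' (by
        filter_upwards [self_mem_nhdsWithin] with s hs using (hcrit s hs).symm))
      simp [h2]
    · simp [hcrit t h]
  have hfix : ∀ t, 0 ≤ t → γ t = γ 0 := fun t ht => by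
    have := norm_integralCurve_sub_le hγ hcrit' le_rfl ht
    rwa [zero_mul, norm_le_zero_iff, sub_eq_zero] at this
  refine tendsto_nhds_unique (tendsto_const_nhds.congr' ?_) hlim
  filter_upwards [eventually_ge_atTop 0] with t ht using (hfix t ht).symm

/-- A solution starting at a critical point stays there. This uniqueness follows from the shadowing
lemma: the constant sequence is an exact Euler scheme, so every `γ t` is a cluster point of it. -/
theorem gradient_ne_zero_of_mem_domainOfAttraction (hf : ContDiff ℝ 2 f) {y : Vec N}
    (hy : y ∈ domainOfAttraction f xs) (hne : y ≠ xs) : gradient f y ≠ 0 := by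
  intro hcrit
  obtain ⟨γ, hγ, rfl, hlim⟩ := hy
  obtain ⟨R, hR⟩ := hγ.exists_norm_le hlim
  obtain ⟨L, hL, hLip⟩ := exists_lipschitz_gradient hf R
  refine hne (tendsto_nhds_unique (tendsto_const_nhds.congr' ?_) hlim)
  filter_upwards [eventually_ge_atTop 0] with t ht
  -- The steps `1 / (n + 1)` are an arbitrary choice tending to zero with divergent sum.
  have hcl := mapClusterPt_integralCurve hL hLip (a := fun n => 1 / ((n : ℝ) + 1))
    (fun n => by positivity) tendsto_one_div_add_atTop_nhds_zero_nat
    Real.tendsto_sum_range_one_div_nat_succ_atTop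
    (z := fun _ => γ 0) (e := fun _ => 0) (fun n => by simp [hcrit]) tendsto_const_nhds
    (fun _ => hR 0 le_rfl) hγ hR tendsto_const_nhds.mapClusterPt ht
  by_contra hcon
  exact (mapClusterPt_iff_frequently.1 hcl _ (isOpen_compl_singleton.mem_nhds (Ne.symm hcon)))
    (Eventually.of_forall fun _ h => h rfl)

end Flow

/-! ### Convergence of perturbed gradient descent -/

section Descent

variable {N : ℕ} {f : Vec N → ℝ} {xs : Vec N} {a : ℕ → ℝ}

/-- In the first order expansion the error `e` costs at most `B * ‖e‖` through its inner product
with the gradient, and the quadratic remainder at most `L * t * B ^ 2`, both per unit of step size.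
-/
theorem descent_step (hf : Differentiable ℝ f) {L R : ℝ} (hL : 0 ≤ L)
    (hLip : ∀ x y, ‖x‖ ≤ R → ‖y‖ ≤ R → ‖gradient f x - gradient f y‖ ≤ L * ‖x - y‖)
    {x e : Vec N} {B t : ℝ} (ht : 0 ≤ t) (hx : ‖x‖ ≤ R)
    (hx' : ‖x - t • (gradient f x + e)‖ ≤ R) (hB : ‖gradient f x + e‖ ≤ B)
    (hB' : ‖gradient f x‖ ≤ B) :
    f (x - t • (gradient f x + e)) ≤
      f x - t * (‖gradient f x‖ ^ 2 - (B * ‖e‖ + L * t * B ^ 2)) := by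
  have h := (abs_le.1 (abs_sub_sub_inner_le hf hLip hL hx hx')).2
  have h1 : x - t • (gradient f x + e) - x = -(t • (gradient f x + e)) := by abel
  rw [h1, norm_neg, norm_smul, Real.norm_eq_abs, abs_of_nonneg ht, inner_neg_right,
    inner_smul_right, inner_add_right, real_inner_self_eq_norm_sq] at h
  have h2 : -(B * ‖e‖) ≤ inner ℝ (gradient f x) e := by
    have := (abs_le.1 (abs_real_inner_le_norm (gradient f x) e)).1
    nlinarith [norm_nonneg e]
  have h3 : L * (t * ‖gradient f x + e‖) ^ 2 ≤ L * (t * B) ^ 2 := by gcongr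
  nlinarith [mul_le_mul_of_nonneg_left h2 ht]

/-- A bounded perturbed gradient descent which accumulates at an isolated critical point that is a
strict local minimum converges to it. -/
theorem tendsto_of_mapClusterPt_of_strict_min (hf : ContDiff ℝ 2 f) {r : ℝ} (hr : 0 < r)
    (hmin : ∀ y ∈ Metric.ball xs r, y ≠ xs → f xs < f y ∧ gradient f y ≠ 0)
    (ha_pos : ∀ n, 0 < a n) (ha : Tendsto a atTop (𝓝 0))
    {z e : ℕ → Vec N} (hz : ∀ n, z (n + 1) = z n - a n • (gradient f (z n) + e n))
    (he : Tendsto e atTop (𝓝 0)) {R : ℝ} (hzR : ∀ n, ‖z n‖ ≤ R)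
    (hcl : MapClusterPt xs atTop z) : Tendsto z atTop (𝓝 xs) := by
  obtain ⟨L, hL, hLip⟩ := exists_lipschitz_gradient hf R
  have hfd : Differentiable ℝ f := hf.differentiable (by norm_num)
  have hgc : Continuous (gradient f) := (contDiff_gradient hf).continuous
  obtain ⟨B, hB⟩ : ∃ B, ∀ n, ‖gradient f (z n)‖ ≤ B ∧ ‖gradient f (z n) + e n‖ ≤ B := by
    obtain ⟨B₁, hB₁⟩ := (isCompact_closedBall (0 : Vec N) R).exists_bound_of_continuousOn
      hgc.continuousOn
    obtain ⟨B₂, hB₂⟩ := he.norm.bddAbove_range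
    have hB₂' : ∀ n, ‖e n‖ ≤ B₂ := fun n => hB₂ ⟨n, rfl⟩
    have h1 : ∀ n, ‖gradient f (z n)‖ ≤ B₁ := fun n => hB₁ _ (by simpa using hzR n)
    refine ⟨B₁ + B₂, fun n => ⟨?_, (norm_add_le _ _).trans (add_le_add (h1 n) (hB₂' n))⟩⟩
    linarith [h1 n, hB₂' n, norm_nonneg (e n)]
  rw [Metric.tendsto_atTop']
  intro ε₀ hε₀
  set ε := min (ε₀ / 2) (r / 2) with hε_def
  have hε : 0 < ε := by positivity
  have hεr : Metric.closedBall xs ε ⊆ Metric.ball xs r :=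
    Metric.closedBall_subset_ball ((min_le_right _ _).trans_lt (by linarith))
  -- a barrier on the annulus
  obtain ⟨m, hm, hbar⟩ : ∃ m > 0, ∀ y, dist y xs ≤ ε → ε / 2 ≤ dist y xs → f xs + m ≤ f y := by
    have hK : IsCompact (Metric.closedBall xs ε ∩ {y | ε / 2 ≤ dist y xs}) :=
      (isCompact_closedBall _ _).inter_right (isClosed_le continuous_const (by fun_prop))
    rcases Set.eq_empty_or_nonempty (Metric.closedBall xs ε ∩ {y | ε / 2 ≤ dist y xs}) with h | h
    · exact ⟨1, one_pos, fun y h1 h2 => absurd (show y ∈ (∅ : Set (Vec N)) from h ▸ ⟨h1, h2⟩)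
        (by simp)⟩
    · obtain ⟨y₀, hy₀, hy₀min⟩ := hK.exists_isMinOn h hfd.continuous.continuousOn
      have hne : y₀ ≠ xs := by
        rintro rfl
        have := hy₀.2
        simp at this
        linarith
      refine ⟨f y₀ - f xs, sub_pos.2 (hmin _ (hεr hy₀.1) hne).1, fun y h1 h2 => ?_⟩
      have : f y₀ ≤ f y := hy₀min ⟨h1, h2⟩
      linarith
  -- the gradient is bounded below away from the minimum
  obtain ⟨c, hc, hgrad⟩ : ∃ c > 0, ∀ y, dist y xs ≤ ε → f xs + m / 2 ≤ f y →
      c ≤ ‖gradient f y‖ ^ 2 := by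
    have hK : IsCompact (Metric.closedBall xs ε ∩ {y | f xs + m / 2 ≤ f y}) :=
      (isCompact_closedBall _ _).inter_right (isClosed_le continuous_const hfd.continuous)
    rcases Set.eq_empty_or_nonempty (Metric.closedBall xs ε ∩ {y | f xs + m / 2 ≤ f y}) with h | h
    · exact ⟨1, one_pos, fun y h1 h2 => absurd (show y ∈ (∅ : Set (Vec N)) from h ▸ ⟨h1, h2⟩)
        (by simp)⟩
    · obtain ⟨y₀, hy₀, hy₀min⟩ := hK.exists_isMinOn h
        (f := fun y => ‖gradient f y‖ ^ 2) (by fun_prop)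
      have hne : y₀ ≠ xs := by
        rintro rfl
        have := hy₀.2
        simp at this
        linarith
      refine ⟨‖gradient f y₀‖ ^ 2, ?_, fun y h1 h2 => hy₀min ⟨h1, h2⟩⟩
      have := (hmin _ (hεr hy₀.1) hne).2
      positivity
  -- late steps
  have hκ : Tendsto (fun n => B * ‖e n‖ + L * a n * B ^ 2) atTop (𝓝 0) := by
    simpa using (he.norm.const_mul B).add ((ha.const_mul L).mul_const (B ^ 2))
  have haκ : Tendsto (fun n => a n * (B * ‖e n‖ + L * a n * B ^ 2)) atTop (𝓝 0) := by
    simpa using ha.mul hκ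
  have haB : Tendsto (fun n => a n * B) atTop (𝓝 0) := by simpa using ha.mul_const B
  obtain ⟨n₀, hn₀⟩ := eventually_atTop.1 ((hκ.eventually (gt_mem_nhds hc)).and
    ((haκ.eventually (gt_mem_nhds (half_pos hm))).and
      (haB.eventually (gt_mem_nhds (half_pos hε)))))
  -- The trap is invariant. The barrier forces its points into the half ball, and late moves are
  -- shorter than `ε / 2`, so the ball is not left. The level is not exceeded either: below `m / 2`
  -- the possible gain is less than `m / 2`, and above it the descent `c` outweighs the error.
  have hstep : ∀ n ≥ n₀, (dist (z n) xs < ε ∧ f (z n) < f xs + m) →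
      (dist (z (n + 1)) xs < ε ∧ f (z (n + 1)) < f xs + m) := by
    rintro n hn ⟨h1, h2⟩
    obtain ⟨k1, k2, k3⟩ := hn₀ n hn
    have h3 : dist (z n) xs < ε / 2 := by
      by_contra h
      linarith [hbar _ h1.le (not_lt.1 h)]
    have hd := descent_step hfd hL hLip (ha_pos n).le (hzR n) (by rw [← hz]; exact hzR _)
      (hB n).2 (hB n).1
    rw [← hz] at hd
    have hmove : dist (z (n + 1)) (z n) ≤ a n * B := by
      rw [hz, dist_eq_norm, sub_sub_cancel_left, norm_neg, norm_smul, Real.norm_eq_abs,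
        abs_of_pos (ha_pos n)]
      exact mul_le_mul_of_nonneg_left (hB n).2 (ha_pos n).le
    refine ⟨by linarith [dist_triangle (z (n + 1)) (z n) xs], ?_⟩
    have hap := ha_pos n
    rcases lt_or_ge (f (z n)) (f xs + m / 2) with h | h
    · nlinarith [mul_nonneg hap.le (sq_nonneg ‖gradient f (z n)‖)]
    · have := hgrad _ h1.le h
      nlinarith
  obtain ⟨n₁, hn₁, hU⟩ := frequently_atTop.1 (mapClusterPt_iff_frequently.1 hcl
    {y | dist y xs < ε ∧ f y < f xs + m} (by
      refine IsOpen.mem_nhds ?_ ⟨by simpa using hε, by simpa using hm⟩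
      exact (isOpen_lt (continuous_id.dist continuous_const) continuous_const).inter
        (isOpen_lt hfd.continuous continuous_const))) n₀
  have hall : ∀ n ≥ n₁, dist (z n) xs < ε ∧ f (z n) < f xs + m := by
    intro n hn
    induction n, hn using Nat.le_induction with
    | base => exact hU
    | succ n hn ih => exact hstep n (hn₁.trans hn) ih
  refine ⟨n₁, fun n hn => (hall n hn.le).1.trans ?_⟩
  exact (min_le_left _ _).trans_lt (by linarith)

/-- A bounded perturbed gradient descent with an accumulation point in the domain of attraction of
an attracting equilibrium converges to it. -/
theorem tendsto_of_mapClusterPt_domainOfAttraction (hf : ContDiff ℝ 2 f)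
    (hxs : IsAsymptoticallyStable f xs)
    (ha_pos : ∀ n, 0 < a n) (ha : Tendsto a atTop (𝓝 0))
    (ha_sum : Tendsto (fun n => ∑ k ∈ Finset.range n, a k) atTop atTop)
    {z e : ℕ → Vec N} (hz : ∀ n, z (n + 1) = z n - a n • (gradient f (z n) + e n))
    (he : Tendsto e atTop (𝓝 0)) {R : ℝ} (hzR : ∀ n, ‖z n‖ ≤ R)
    {y : Vec N} (hy : y ∈ domainOfAttraction f xs)
    (hcl : MapClusterPt y atTop z) : Tendsto z atTop (𝓝 xs) := by
  obtain ⟨r, hr, hball⟩ := hxs.attracting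
  refine tendsto_of_mapClusterPt_of_strict_min hf hr (fun w hw hne =>
    ⟨lt_of_mem_domainOfAttraction hf (hball hw) hne,
      gradient_ne_zero_of_mem_domainOfAttraction hf (hball hw) hne⟩) ha_pos ha hz he hzR ?_
  obtain ⟨γ, hγ, rfl, hlim⟩ := hy
  obtain ⟨R', hR'⟩ := hγ.exists_norm_le hlim
  obtain ⟨L, hL, hLip⟩ := exists_lipschitz_gradient hf (max R R')
  have hγcl : ∀ t, 0 ≤ t → MapClusterPt (γ t) atTop z := fun t ht =>
    mapClusterPt_integralCurve hL hLip (fun n => (ha_pos n).le) ha ha_sum hz he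
      (fun n => (hzR n).trans (le_max_left _ _)) hγ
      (fun t ht => (hR' t ht).trans (le_max_right _ _)) hcl ht
  -- The cluster points form a closed set containing the whole flow line, hence also its limit.
  exact isClosed_setOfPred_clusterPt.mem_of_tendsto hlim
    (by filter_upwards [eventually_ge_atTop 0] with t ht using hγcl t ht)

/-- Deterministic convergence theorem for stochastic gradient schemes: vanishing bias and summable
noise. -/
theorem tendsto_of_convergent_noise (hf : ContDiff ℝ 2 f)
    (hxs : IsAsymptoticallyStable f xs)
    (ha_pos : ∀ n, 0 < a n) (ha : Tendsto a atTop (𝓝 0))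
    (ha_sum : Tendsto (fun n => ∑ k ∈ Finset.range n, a k) atTop atTop)
    {x b m : ℕ → Vec N} (hx : ∀ n, x (n + 1) = x n - a n • (gradient f (x n) + b n + m n))
    (hb : Tendsto b atTop (𝓝 0)) {S : Vec N}
    (hm : Tendsto (fun n => ∑ k ∈ Finset.range n, a k • m k) atTop (𝓝 S))
    {R : ℝ} (hxR : ∀ n, ‖x n‖ ≤ R)
    {D : Set (Vec N)} (hD : IsCompact D) (hDsub : D ⊆ domainOfAttraction f xs)
    (hvisit : ∃ᶠ n in atTop, x n ∈ D) : Tendsto x atTop (𝓝 xs) := by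
  -- The tail of the noise series. In `z = x - s` the term `a n • m n` cancels, and evaluating the
  -- gradient at `x n` rather than `z n` costs at most `L * ‖s n‖`, which tends to zero.
  set s : ℕ → Vec N := fun n => S - ∑ k ∈ Finset.range n, a k • m k with hs
  have hs0 : Tendsto s atTop (𝓝 0) := by
    simpa [hs] using (tendsto_const_nhds (x := S)).sub hm
  set z : ℕ → Vec N := fun n => x n - s n with hz
  obtain ⟨C, hC⟩ := hs0.norm.bddAbove_range
  have hC' : ∀ n, ‖s n‖ ≤ C := fun n => hC ⟨n, rfl⟩
  have hC0 : 0 ≤ C := (norm_nonneg _).trans (hC' 0)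
  have hzR : ∀ n, ‖z n‖ ≤ R + C := fun n =>
    (norm_sub_le _ _).trans (add_le_add (hxR n) (hC' n))
  obtain ⟨L, hL, hLip⟩ := exists_lipschitz_gradient hf (R + C)
  obtain ⟨y, hyD, hy⟩ := hD.exists_mapClusterPt_of_frequently hvisit
  have hxz : x = fun n => z n + s n := by ext n : 1; simp [hz]
  suffices h : Tendsto z atTop (𝓝 xs) by
    rw [hxz]; simpa using h.add hs0
  refine tendsto_of_mapClusterPt_domainOfAttraction hf hxs ha_pos ha ha_sum (z := z)
    (e := fun n => b n + (gradient f (x n) - gradient f (z n))) (fun n => ?_) ?_ hzR (hDsub hyD) ?_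
  · simp only [hz, hs, hx, Finset.sum_range_succ, smul_add, smul_sub]
    abel
  · rw [← add_zero (0 : Vec N)]
    refine hb.add (squeeze_zero_norm (a := fun n => L * ‖s n‖) (fun n => ?_) ?_)
    · have := hLip (x n) (z n) (by linarith [hxR n]) (hzR n)
      rwa [show x n - z n = s n by simp [hz]] at this
    · simpa using hs0.norm.const_mul L
  · rw [mapClusterPt_iff_frequently]
    intro U hU
    obtain ⟨ε, hε, hεU⟩ := Metric.mem_nhds_iff.1 hU
    have h1 := mapClusterPt_iff_frequently.1 hy _ (Metric.ball_mem_nhds y (half_pos hε))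
    have h2 := hs0.norm.eventually (gt_mem_nhds (by simpa using half_pos hε : ‖(0 : Vec N)‖ < ε / 2))
    refine (h1.and_eventually h2).mono fun n hn => hεU ?_
    rw [mem_ball_iff_norm] at hn ⊢
    calc ‖z n - y‖ = ‖(x n - y) - s n‖ := by simp only [hz]; congr 1; abel
      _ ≤ ‖x n - y‖ + ‖s n‖ := norm_sub_le _ _
      _ < ε := by linarith [hn.1, hn.2]

end Descent

/-! ### The perturbation laws -/

section Law

theorem Perturbation.scale_pos (p : Perturbation) : 0 < p.scale := by
  cases p <;> simp only [Perturbation.scale] <;> positivity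

theorem Perturbation.exists_ae_abs_le (p : Perturbation) :
    ∃ K : ℝ, 0 ≤ K ∧ ∀ᵐ t ∂p.law, |t| ≤ K := by
  cases p with
  | uniform η hη =>
    refine ⟨η, hη.le, ?_⟩
    filter_upwards [ProbabilityTheory.ae_cond_mem measurableSet_Icc] with t ht
    exact abs_le.2 ht
  | asymBernoulli ε hε =>
    refine ⟨1 + ε, by positivity, ?_⟩
    rw [Perturbation.law, ae_add_measure_iff]
    constructor <;> refine Measure.ae_smul_measure ?_ _ <;>
      rw [ae_dirac_iff (measurableSet_le (by fun_prop) (by fun_prop))]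
    · simp [hε.le]
    · rw [abs_of_pos (by positivity)]

theorem integral_uniform_law (η : ℝ) (hη : 0 < η) (g : ℝ → ℝ) :
    ∫ t, g t ∂(Perturbation.uniform η hη).law = (2 * η)⁻¹ * ∫ t in (-η)..η, g t := by
  rw [Perturbation.law, ProbabilityTheory.cond, integral_smul_measure, Real.volume_Icc,
    ENNReal.toReal_inv, ENNReal.toReal_ofReal (by linarith),
    intervalIntegral.integral_of_le (by linarith), integral_Icc_eq_integral_Ioc, smul_eq_mul]
  congr 2; ring

theorem integral_asymBernoulli_law (ε : ℝ) (hε : 0 < ε) (g : ℝ → ℝ) :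
    ∫ t, g t ∂(Perturbation.asymBernoulli ε hε).law =
      (1 + ε) / (2 + ε) * g (-1) + 1 / (2 + ε) * g (1 + ε) := by
  have hint : ∀ x : ℝ, Integrable g (Measure.dirac x) := fun x =>
    (integrable_dirac (by simp))
  rw [Perturbation.law, integral_add_measure ((hint _).smul_measure ENNReal.ofReal_ne_top)
    ((hint _).smul_measure ENNReal.ofReal_ne_top), integral_smul_measure, integral_smul_measure,
    integral_dirac, integral_dirac, ENNReal.toReal_ofReal (by positivity),
    ENNReal.toReal_ofReal (by positivity), smul_eq_mul, smul_eq_mul]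

theorem Perturbation.integral_id (p : Perturbation) : ∫ t, t ∂p.law = 0 := by
  cases p with
  | uniform η hη => rw [integral_uniform_law, _root_.integral_id]; ring
  | asymBernoulli ε hε => rw [integral_asymBernoulli_law]; ring

/-- The variance is `η² / 3` in the uniform case and `1 + ε` in the Bernoulli case; this is what
dictates the scaling factors. -/
theorem Perturbation.scale_mul_integral_sq (p : Perturbation) :
    p.scale * ∫ t, t ^ 2 ∂p.law = 1 := by
  cases p with
  | uniform η hη =>
    rw [integral_uniform_law, integral_pow, Perturbation.scale]
    field_simp
    ring
  | asymBernoulli ε hε =>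
    rw [integral_asymBernoulli_law, Perturbation.scale]
    field_simp
    ring

end Law

/-! ### Martingale noise and conditional expectations -/

section Conditional

/-- Freezing lemma: conditioning on a σ-field that makes `X` measurable and is independent of `D`
amounts to integrating out `D`. -/
theorem condExp_ae_eq_integral_of_indep {Ω : Type*} {m m0 : MeasurableSpace Ω} {μ : Measure Ω}
    [IsProbabilityMeasure μ] {V W : Type*} [MeasurableSpace V] [MeasurableSpace W]
    (hm : m ≤ m0) {D : Ω → V} {X : Ω → W}
    (hD : Measurable D) (hX : Measurable[m] X)
    (hind : Indep (MeasurableSpace.comap D inferInstance) m μ)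
    {h : W → V → ℝ} (hh : Measurable (Function.uncurry h))
    (hint : Integrable (fun ω => h (X ω) (D ω)) μ) :
    μ[fun ω => h (X ω) (D ω) | m] =ᵐ[μ] fun ω => ∫ ω', h (X ω) (D ω') ∂μ := by
  have : IsProbabilityMeasure (μ.map D) := Measure.isProbabilityMeasure_map hD.aemeasurable
  have hGeq : ∀ w, ∫ ω', h w (D ω') ∂μ = ∫ v, h w v ∂(μ.map D) := fun w =>
    (integral_map hD.aemeasurable (by
      have : Measurable (h w) := hh.comp measurable_prodMk_left
      exact this.aestronglyMeasurable)).symm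
  have hGm : StronglyMeasurable fun w => ∫ v, h w v ∂(μ.map D) :=
    hh.stronglyMeasurable.integral_prod_right
  have key : ∀ s, MeasurableSet[m] s →
      Integrable (s.indicator fun ω => ∫ v, h (X ω) v ∂(μ.map D)) μ ∧
      ∫ ω in s, h (X ω) (D ω) ∂μ = ∫ ω in s, (∫ v, h (X ω) v ∂(μ.map D)) ∂μ := by
    intro s hs
    have hs0 := hm s hs
    -- Pairing `X` with the indicator of `s` gives one `m`-measurable variable independent of `D`,
    -- so Fubini for the product law handles the integral over `s`.
    set Z : Ω → W × ℝ := fun ω => (X ω, s.indicator (fun _ => (1 : ℝ)) ω) with hZ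
    have hZm : Measurable[m] Z := hX.prodMk (measurable_const.indicator hs)
    have hZ0 : Measurable Z := hZm.mono hm le_rfl
    have hZD : IndepFun Z D μ := by
      rw [IndepFun_iff_Indep]
      exact (indep_of_indep_of_le_right hind hZm.comap_le).symm
    have hprod := (indepFun_iff_map_prod_eq_prod_map_map hZ0.aemeasurable hD.aemeasurable).1 hZD
    have : IsProbabilityMeasure (μ.map Z) := Measure.isProbabilityMeasure_map hZ0.aemeasurable
    set H : (W × ℝ) × V → ℝ := fun q => q.1.2 * h q.1.1 q.2 with hH
    have hHm : Measurable H :=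
      (measurable_snd.comp measurable_fst).mul
        (hh.comp ((measurable_fst.comp measurable_fst).prodMk measurable_snd))
    have hHeq : ∀ ω, H (Z ω, D ω) = s.indicator (fun ω => h (X ω) (D ω)) ω := fun ω => by
      by_cases hω : ω ∈ s <;> simp [hH, hZ, hω]
    have hHint : Integrable H ((μ.map Z).prod (μ.map D)) := by
      rw [← hprod, integrable_map_measure hHm.aestronglyMeasurable
        (hZ0.prodMk hD).aemeasurable]
      exact (hint.indicator hs0).congr (Eventually.of_forall fun ω => (hHeq ω).symm)
    have hinner : ∀ ω, ∫ v, H (Z ω, v) ∂(μ.map D) =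
        s.indicator (fun ω => ∫ v, h (X ω) v ∂(μ.map D)) ω := fun ω => by
      by_cases hω : ω ∈ s <;> simp [hH, hZ, hω]
    have hI := hHint.integral_prod_left
    constructor
    · have := hI.comp_measurable hZ0
      exact this.congr (Eventually.of_forall hinner)
    · rw [← integral_indicator hs0, ← integral_indicator hs0]
      calc ∫ ω, s.indicator (fun ω => h (X ω) (D ω)) ω ∂μ = ∫ ω, H (Z ω, D ω) ∂μ := by
            simp_rw [hHeq]
        _ = ∫ q, H q ∂((μ.map Z).prod (μ.map D)) := by
            rw [← hprod, integral_map (hZ0.prodMk hD).aemeasurable hHm.aestronglyMeasurable]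
        _ = ∫ z, (∫ v, H (z, v) ∂(μ.map D)) ∂(μ.map Z) := integral_prod _ hHint
        _ = ∫ ω, (∫ v, H (Z ω, v) ∂(μ.map D)) ∂μ :=
            integral_map hZ0.aemeasurable hI.aestronglyMeasurable
        _ = _ := by simp_rw [hinner]
  simp_rw [hGeq]
  refine (ae_eq_condExp_of_forall_setIntegral_eq hm hint (fun s hs _ => ?_) (fun s hs _ => ?_)
    ?_).symm
  · exact (integrable_indicator_iff (hm s hs)).1 (key s hs).1
  · exact (key s hs).2.symm
  · exact (hGm.comp_measurable hX).aestronglyMeasurable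

variable {Ω : Type*} {m0 : MeasurableSpace Ω} {μ : Measure Ω} [IsProbabilityMeasure μ]

theorem integral_sq_sub_condExp_le {m : MeasurableSpace Ω} (hm : m ≤ m0) {Y : Ω → ℝ}
    (hY : MemLp Y 2 μ) : ∫ ω, ((Y - μ[Y | m]) ω) ^ 2 ∂μ ≤ ∫ ω, Y ω ^ 2 ∂μ := by
  calc ∫ ω, ((Y - μ[Y | m]) ω) ^ 2 ∂μ = ∫ ω, (Var[Y; μ | m]) ω ∂μ := (integral_condExp hm).symm
    _ ≤ ∫ ω, (μ[Y ^ 2 | m]) ω ∂μ :=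
        integral_mono_ae integrable_condExp integrable_condExp (condVar_ae_le_condExp_sq hm hY)
    _ = ∫ ω, Y ω ^ 2 ∂μ := integral_condExp hm

theorem condExp_sub_condExp_self {m : MeasurableSpace Ω} (hm : m ≤ m0) {Y : Ω → ℝ}
    (hY : Integrable Y μ) : μ[Y - μ[Y | m] | m] =ᵐ[μ] 0 := by
  refine (condExp_sub hY integrable_condExp m).trans ?_
  rw [condExp_of_stronglyMeasurable hm stronglyMeasurable_condExp integrable_condExp, sub_self]

/-- Square summable martingale differences are almost surely summable. -/
theorem ae_exists_tendsto_sum_sub_condExp {ℱ : Filtration ℕ m0} {Y : ℕ → Ω → ℝ}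
    (hmeas : ∀ n, StronglyMeasurable[ℱ (n + 1)] (Y n)) (hY : ∀ n, MemLp (Y n) 2 μ)
    (hsum : Summable fun n => ∫ ω, Y n ω ^ 2 ∂μ) :
    ∀ᵐ ω ∂μ, ∃ c, Tendsto
      (fun n => ∑ k ∈ Finset.range n, (Y k - μ[Y k | ℱ k]) ω) atTop (𝓝 c) := by
  set M : ℕ → Ω → ℝ := fun k => Y k - μ[Y k | ℱ k] with hM
  set S : ℕ → Ω → ℝ := fun n => ∑ k ∈ Finset.range n, M k with hS
  have hML : ∀ k, MemLp (M k) 2 μ := fun k => (hY k).sub ((hY k).condExp (by norm_num))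
  have hSL : ∀ n, MemLp (S n) 2 μ := fun n => memLp_finsetSum' _ fun k _ => hML k
  have hS_succ : ∀ n, S (n + 1) = S n + M n := fun n => Finset.sum_range_succ _ _
  have hMm : ∀ k, StronglyMeasurable[ℱ (k + 1)] (M k) := fun k =>
    (hmeas k).sub (stronglyMeasurable_condExp.mono (ℱ.mono (Nat.le_succ k)))
  have hSm : ∀ n, StronglyMeasurable[ℱ n] (S n) := fun n =>
    Finset.stronglyMeasurable_sum _ fun k hk =>
      (hMm k).mono (ℱ.mono (Finset.mem_range.1 hk))
  have hM0 : ∀ k, μ[M k | ℱ k] =ᵐ[μ] 0 := fun k =>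
    condExp_sub_condExp_self (ℱ.le k) ((hY k).integrable (by norm_num))
  -- Martingale increments are orthogonal to the past, so second moments add up.
  have horth : ∀ n, ∫ ω, S n ω * M n ω ∂μ = 0 := fun n => by
    have hint : Integrable (S n * M n) μ := (hSL n).integrable_mul (hML n)
    have h1 : μ[S n * M n | ℱ n] =ᵐ[μ] 0 :=
      (condExp_mul_of_stronglyMeasurable_left (hSm n) hint
        ((hML n).integrable (by norm_num))).trans (by
          filter_upwards [hM0 n] with ω hω
          simp [hω])
    calc ∫ ω, S n ω * M n ω ∂μ = ∫ ω, (μ[S n * M n | ℱ n]) ω ∂μ := (integral_condExp (ℱ.le n)).symm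
      _ = 0 := by rw [integral_congr_ae h1]; simp
  have hS2 : ∀ n, ∫ ω, S n ω ^ 2 ∂μ ≤ ∑ k ∈ Finset.range n, ∫ ω, Y k ω ^ 2 ∂μ := by
    intro n
    induction n with
    | zero => simp [hS]
    | succ n ih =>
      have h1 : ∀ ω, S (n + 1) ω ^ 2 = S n ω ^ 2 + 2 * (S n ω * M n ω) + M n ω ^ 2 := fun ω => by
        rw [hS_succ, Pi.add_apply]; ring
      have i1 : Integrable (fun ω => S n ω * M n ω) μ := (hSL n).integrable_mul (hML n)
      rw [Finset.sum_range_succ, integral_congr_ae (Eventually.of_forall h1),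
        integral_add (f := fun ω => S n ω ^ 2 + 2 * (S n ω * M n ω))
          ((hSL n).integrable_sq.add (i1.const_mul 2)) (hML n).integrable_sq,
        integral_add (hSL n).integrable_sq (i1.const_mul 2), integral_const_mul, horth]
      linarith [integral_sq_sub_condExp_le (ℱ.le n) (hY n)]
  have hmart : Martingale S ℱ μ := by
    refine martingale_of_condExp_sub_eq_zero_nat hSm (fun n => (hSL n).integrable (by norm_num))
      fun n => ?_
    rw [hS_succ, add_sub_cancel_left]
    exact hM0 n
  -- Martingale convergence needs only an `L¹` bound, which the `L²` bound gives through `|s| ≤ 1 +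
  -- s ^ 2`.
  have hbdd : ∀ n, eLpNorm (S n) 1 μ ≤
      (Real.toNNReal (1 + ∑' k, ∫ ω, Y k ω ^ 2 ∂μ) : ENNReal) := fun n => by
    have hint : Integrable (S n) μ := (hSL n).integrable (by norm_num)
    rw [eLpNorm_one_eq_lintegral_enorm, ← ofReal_integral_norm_eq_lintegral_enorm hint]
    refine ENNReal.ofReal_le_ofReal ?_
    calc ∫ ω, ‖S n ω‖ ∂μ ≤ ∫ ω, (1 + S n ω ^ 2) ∂μ := by
          refine integral_mono hint.norm ((integrable_const _).add (hSL n).integrable_sq) fun ω => ?_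
          simp only [Real.norm_eq_abs]
          nlinarith [sq_abs (S n ω), sq_nonneg (|S n ω| - 1), abs_nonneg (S n ω)]
      _ = 1 + ∫ ω, S n ω ^ 2 ∂μ := by
          rw [integral_add (integrable_const _) (hSL n).integrable_sq]; simp
      _ ≤ _ := by
          gcongr
          exact (hS2 n).trans (hsum.sum_le_tsum _ fun k _ => integral_nonneg fun ω => sq_nonneg _)
  filter_upwards [hmart.submartingale.exists_ae_tendsto_of_bdd hbdd] with ω hω
  simpa [hS, hM] using hω

/-- Rests on `t ^ 2 ≤ 1 + |t| ^ (2 + ζ)`. The moment is a `lintegral`, so its finiteness yields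
integrability instead of presupposing it. -/
theorem memLp_two_and_integral_sq_le {X : Ω → ℝ} (hX : AEStronglyMeasurable X μ) {ζ α : ℝ}
    (hζ : 0 < ζ) (hα : 0 < α)
    (h : ∫⁻ ω, ENNReal.ofReal (|X ω| ^ (2 + ζ)) ∂μ ≤ ENNReal.ofReal α) :
    MemLp X 2 μ ∧ ∫ ω, X ω ^ 2 ∂μ ≤ 1 + α := by
  have hpt : ∀ t : ℝ, t ^ 2 ≤ 1 + |t| ^ (2 + ζ) := fun t => by
    have h0 : 0 ≤ |t| ^ (2 + ζ) := by positivity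
    rcases le_total |t| 1 with ht | ht
    · have : t ^ 2 ≤ 1 := by rw [← sq_abs]; exact pow_le_one₀ (abs_nonneg t) ht
      linarith
    · have : |t| ^ (2 : ℝ) ≤ |t| ^ (2 + ζ) := Real.rpow_le_rpow_of_exponent_le ht (by linarith)
      rw [Real.rpow_two, sq_abs] at this
      linarith
  have hlint : ∫⁻ ω, ENNReal.ofReal (X ω ^ 2) ∂μ ≤ ENNReal.ofReal (1 + α) := by
    calc ∫⁻ ω, ENNReal.ofReal (X ω ^ 2) ∂μ
        ≤ ∫⁻ ω, (1 + ENNReal.ofReal (|X ω| ^ (2 + ζ))) ∂μ := by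
          refine lintegral_mono fun ω => ?_
          rw [← ENNReal.ofReal_one, ← ENNReal.ofReal_add zero_le_one (by positivity)]
          exact ENNReal.ofReal_le_ofReal (hpt _)
      _ = 1 + ∫⁻ ω, ENNReal.ofReal (|X ω| ^ (2 + ζ)) ∂μ := by
          rw [lintegral_add_left measurable_const]; simp
      _ ≤ 1 + ENNReal.ofReal α := by gcongr
      _ = ENNReal.ofReal (1 + α) := by
          rw [ENNReal.ofReal_add zero_le_one hα.le, ENNReal.ofReal_one]
  have hm2 : AEStronglyMeasurable (fun ω => X ω ^ 2) μ := hX.pow 2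
  refine ⟨(memLp_two_iff_integrable_sq hX).2 ⟨hm2, ?_⟩, ?_⟩
  · rw [hasFiniteIntegral_iff_ofReal (Eventually.of_forall fun ω => sq_nonneg _)]
    exact hlint.trans_lt ENNReal.ofReal_lt_top
  · rw [integral_eq_lintegral_of_nonneg_ae (Eventually.of_forall fun ω => sq_nonneg _) hm2]
    exact ENNReal.toReal_le_of_le_ofReal (by positivity) hlint

end Conditional

end RDSA

noncomputable section

namespace RDSA

/-! ### Bias and variance of the gradient estimate -/

theorem tendsto_vec_iff {N : ℕ} {ι : Type*} {l : Filter ι} {u : ι → Vec N} {v : Vec N} :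
    Tendsto u l (𝓝 v) ↔ ∀ i, Tendsto (fun n => u n i) l (𝓝 (v i)) := by
  rw [(PiLp.homeomorph 2 fun _ : Fin N => ℝ).isInducing.tendsto_nhds_iff, tendsto_pi_nhds]
  rfl

theorem norm_le_of_forall_abs_le {N : ℕ} {v : Vec N} {K : ℝ} (hK : 0 ≤ K) (hv : ∀ i, |v i| ≤ K) :
    ‖v‖ ≤ N * K := by
  have h1 : ‖v‖ ^ 2 ≤ N * K ^ 2 := by
    rw [EuclideanSpace.norm_sq_eq]
    calc ∑ i, ‖v i‖ ^ 2 ≤ ∑ _i : Fin N, K ^ 2 := by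
          gcongr with i
          exact hv i
      _ = N * K ^ 2 := by simp
  have h2 : (N : ℝ) ≤ (N : ℝ) ^ 2 := by exact_mod_cast Nat.le_self_pow two_ne_zero N
  refine le_of_sq_le_sq (h1.trans ?_) (by positivity)
  rw [mul_pow]
  gcongr

/-- Two first order remainders of size `L * (δ * K) ^ 2`, divided by `2 * δ`. The condition `δ ≤ 1`
keeps both evaluation points in the ball of radius `R + K`. -/
theorem abs_symmetricQuotient_sub_inner_le {N : ℕ} {f : Vec N → ℝ} (hf : Differentiable ℝ f)
    {L R K δ : ℝ} (hL : 0 ≤ L)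
    (hLip : ∀ x y, ‖x‖ ≤ R + K → ‖y‖ ≤ R + K → ‖gradient f x - gradient f y‖ ≤ L * ‖x - y‖)
    {x v : Vec N} (hx : ‖x‖ ≤ R) (hv : ‖v‖ ≤ K) (hδ : 0 < δ) (hδ1 : δ ≤ 1) :
    |(f (x + δ • v) - f (x - δ • v)) / (2 * δ) - inner ℝ (gradient f x) v| ≤ L * K ^ 2 * δ := by
  have hK : 0 ≤ K := (norm_nonneg _).trans hv
  have hδv : ‖δ • v‖ ≤ δ * K := by
    rw [norm_smul, Real.norm_eq_abs, abs_of_pos hδ]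
    gcongr
  have hδK : δ * K ≤ K := mul_le_of_le_one_left hK hδ1
  have hsq : L * ‖δ • v‖ ^ 2 ≤ L * (δ * K) ^ 2 := by gcongr
  have h1 := abs_sub_sub_inner_le hf hLip hL (x := x) (y := x + δ • v) (by linarith)
    ((norm_add_le _ _).trans (by linarith))
  have h2 := abs_sub_sub_inner_le hf hLip hL (x := x) (y := x - δ • v) (by linarith)
    ((norm_sub_le _ _).trans (by linarith))
  rw [add_sub_cancel_left, inner_smul_right] at h1
  rw [sub_sub_cancel_left, norm_neg, inner_neg_right, inner_smul_right] at h2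
  have heq : (f (x + δ • v) - f (x - δ • v)) / (2 * δ) - inner ℝ (gradient f x) v =
      ((f (x + δ • v) - f x - δ * inner ℝ (gradient f x) v) -
        (f (x - δ • v) - f x - -(δ * inner ℝ (gradient f x) v))) / (2 * δ) := by
    field_simp
    ring
  rw [heq, abs_div, abs_of_pos (by positivity : 0 < 2 * δ), div_le_iff₀ (by positivity)]
  refine (abs_sub _ _).trans ?_
  linarith

/-- The symmetric difference quotient estimate of the gradient without measurement noise,
in coordinate `i`. -/
def noiselessEstimate {N : ℕ} (p : Perturbation) (f : Vec N → ℝ) (δ : ℝ) (i : Fin N)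
    (x v : Vec N) : ℝ :=
  p.scale * ((f (x + δ • v) - f (x - δ • v)) / (2 * δ)) * v i

/-- The gradient estimate without measurement noise, with the difference quotient replaced by the
directional derivative. -/
def linearEstimate {N : ℕ} (p : Perturbation) (f : Vec N → ℝ) (i : Fin N) (x v : Vec N) : ℝ :=
  p.scale * inner ℝ (gradient f x) v * v i

/-- The mean of the gradient estimate at the point `x`. -/
def meanEstimate {N : ℕ} {Ω : Type*} [MeasurableSpace Ω] (μ : Measure Ω) (p : Perturbation)
    (f : Vec N → ℝ) (δ : ℝ) (d : Ω → Vec N) (x : Vec N) : Vec N :=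
  WithLp.toLp 2 fun i => ∫ ω, noiselessEstimate p f δ i x (d ω) ∂μ

theorem abs_noiselessEstimate_sub_linearEstimate_le {N : ℕ} {p : Perturbation} {f : Vec N → ℝ}
    (hf : ContDiff ℝ 1 f) {L R K δ : ℝ} (hK0 : 0 ≤ K) (hL : 0 ≤ L)
    (hLip : ∀ x y, ‖x‖ ≤ R + N * K → ‖y‖ ≤ R + N * K →
      ‖gradient f x - gradient f y‖ ≤ L * ‖x - y‖)
    {x v : Vec N} (hx : ‖x‖ ≤ R) (hv : ∀ i, |v i| ≤ K) (hδ : 0 < δ) (hδ1 : δ ≤ 1) (i : Fin N) :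
    |noiselessEstimate p f δ i x v - linearEstimate p f i x v| ≤
      p.scale * (L * (N * K) ^ 2 * δ) * K := by
  have h1 := abs_symmetricQuotient_sub_inner_le (hf.differentiable (by norm_num)) hL hLip hx
    (norm_le_of_forall_abs_le hK0 hv) hδ hδ1
  rw [noiselessEstimate, linearEstimate, ← sub_mul, ← mul_sub, abs_mul, abs_mul,
    abs_of_pos p.scale_pos]
  exact mul_le_mul (mul_le_mul_of_nonneg_left h1 p.scale_pos.le) (hv i) (abs_nonneg _)
    (mul_nonneg p.scale_pos.le (by positivity))

theorem abs_linearEstimate_le {N : ℕ} {p : Perturbation} {f : Vec N → ℝ} {K : ℝ} (hK0 : 0 ≤ K)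
    {x v : Vec N} (hv : ∀ i, |v i| ≤ K) (i : Fin N) :
    |linearEstimate p f i x v| ≤ p.scale * (‖gradient f x‖ * (N * K)) * K := by
  have h1 : |inner ℝ (gradient f x) v| ≤ ‖gradient f x‖ * (N * K) :=
    (abs_real_inner_le_norm _ _).trans
      (mul_le_mul_of_nonneg_left (norm_le_of_forall_abs_le hK0 hv) (norm_nonneg _))
  rw [linearEstimate, abs_mul, abs_mul, abs_of_pos p.scale_pos]
  exact mul_le_mul (mul_le_mul_of_nonneg_left h1 p.scale_pos.le) (hv i) (abs_nonneg _)
    (mul_nonneg p.scale_pos.le (by positivity))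

theorem measurable_noiselessEstimate {N : ℕ} (p : Perturbation) {f : Vec N → ℝ}
    (hf : Continuous f) (δ : ℝ) (i : Fin N) :
    Measurable (Function.uncurry (noiselessEstimate p f δ i)) := by
  refine Continuous.measurable ?_
  unfold Function.uncurry noiselessEstimate
  fun_prop

theorem gradEstimate_apply {N : ℕ} (p : Perturbation) (f : Vec N → ℝ) (δ : ℝ) (x d : Vec N)
    (ξp ξm : ℝ) (i : Fin N) :
    gradEstimate p f δ x d ξp ξm i =
      noiselessEstimate p f δ i x d + p.scale / (2 * δ) * d i * (ξp - ξm) := by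
  simp only [gradEstimate, noiselessEstimate, PiLp.smul_apply, smul_eq_mul]
  ring

/-! ### Bias of the estimate at a fixed point -/

section Bias

variable {N : ℕ} {Ω : Type*} [MeasurableSpace Ω] {μ : Measure Ω} [IsProbabilityMeasure μ]
  {p : Perturbation} {d : Ω → Vec N} {K : ℝ}

/-- Expanding the inner product gives `∑ j, g j * E[d_j d_i]`. The terms `j ≠ i` vanish by
independence and centring, and the scale normalises the remaining variance. -/
theorem scale_mul_integral_inner_mul (hd : Measurable d)
    (hK : ∀ᵐ ω ∂μ, ∀ i, |d ω i| ≤ K) (hlaw : ∀ i, μ.map (fun ω => d ω i) = p.law)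
    (hind : Pairwise fun i j => IndepFun (fun ω => d ω i) (fun ω => d ω j) μ)
    (g : Vec N) (i : Fin N) : ∫ ω, p.scale * inner ℝ g (d ω) * d ω i ∂μ = g i := by
  have hdi : ∀ i, Measurable fun ω => d ω i := fun i => by fun_prop
  have hmean : ∀ i, ∫ ω, d ω i ∂μ = 0 := fun i => by
    rw [← p.integral_id, ← hlaw i, integral_map (hdi i).aemeasurable (by fun_prop)]
  have hvar : p.scale * ∫ ω, d ω i ^ 2 ∂μ = 1 := by
    rw [← p.scale_mul_integral_sq, ← hlaw i, integral_map (hdi i).aemeasurable (by fun_prop)]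
  have hint : ∀ j, Integrable (fun ω => p.scale * (g j * (d ω j * d ω i))) μ := fun j => by
    refine (Integrable.const_mul (Integrable.const_mul ?_ _) _)
    refine Integrable.of_bound ((hdi j).mul (hdi i)).aestronglyMeasurable (K * K) ?_
    filter_upwards [hK] with ω hω
    rw [Real.norm_eq_abs, abs_mul]
    exact mul_le_mul (hω j) (hω i) (abs_nonneg _) ((abs_nonneg _).trans (hω j))
  have hexp : ∀ ω, p.scale * inner ℝ g (d ω) * d ω i =
      ∑ j, p.scale * (g j * (d ω j * d ω i)) := fun ω => by
    rw [PiLp.inner_apply, Finset.mul_sum, Finset.sum_mul]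
    refine Finset.sum_congr rfl fun j _ => ?_
    simp only [RCLike.inner_apply, conj_trivial]
    ring
  simp_rw [hexp]
  rw [integral_finsetSum _ fun j _ => hint j, Finset.sum_eq_single i]
  · rw [integral_const_mul, integral_const_mul]
    simp_rw [← pow_two]
    rw [mul_left_comm, hvar, mul_one]
  · intro j _ hj
    rw [integral_const_mul, integral_const_mul, (hind hj).integral_fun_mul_eq_mul_integral
      (hdi j).aestronglyMeasurable (hdi i).aestronglyMeasurable, hmean]
    simp
  · simp

theorem abs_meanEstimate_sub_gradient_le {f : Vec N → ℝ} (hf : ContDiff ℝ 1 f)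
    (hd : Measurable d) (hK0 : 0 ≤ K)
    (hK : ∀ᵐ ω ∂μ, ∀ i, |d ω i| ≤ K) (hlaw : ∀ i, μ.map (fun ω => d ω i) = p.law)
    (hind : Pairwise fun i j => IndepFun (fun ω => d ω i) (fun ω => d ω j) μ)
    {L R δ : ℝ} (hL : 0 ≤ L)
    (hLip : ∀ x y, ‖x‖ ≤ R + N * K → ‖y‖ ≤ R + N * K →
      ‖gradient f x - gradient f y‖ ≤ L * ‖x - y‖)
    {x : Vec N} (hx : ‖x‖ ≤ R) (hδ : 0 < δ) (hδ1 : δ ≤ 1) (i : Fin N) :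
    |meanEstimate μ p f δ d x i - gradient f x i| ≤
      p.scale * (L * (N * K) ^ 2 * δ) * K := by
  have hm1 : Measurable fun ω => noiselessEstimate p f δ i x (d ω) :=
    (measurable_noiselessEstimate p hf.continuous δ i).of_uncurry_left.comp hd
  have hm2 : Measurable fun ω => linearEstimate p f i x (d ω) := by
    have hc : Continuous fun v : Vec N => p.scale * inner ℝ (gradient f x) v * v i :=
      (continuous_const.mul (continuous_const.inner continuous_id)).mul (by fun_prop)
    exact hc.measurable.comp hd
  have hdiff : ∀ᵐ ω ∂μ, ‖noiselessEstimate p f δ i x (d ω) - linearEstimate p f i x (d ω)‖ ≤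
      p.scale * (L * (N * K) ^ 2 * δ) * K := by
    filter_upwards [hK] with ω hω
    exact abs_noiselessEstimate_sub_linearEstimate_le hf hK0 hL hLip hx hω hδ hδ1 i
  have hi2 : Integrable (fun ω => linearEstimate p f i x (d ω)) μ := by
    refine Integrable.of_bound hm2.aestronglyMeasurable
      (p.scale * (‖gradient f x‖ * (N * K)) * K) ?_
    filter_upwards [hK] with ω hω
    exact abs_linearEstimate_le hK0 hω i
  -- Integrable as the integrable linear estimate plus an almost surely bounded difference.
  have hi1 : Integrable (fun ω => noiselessEstimate p f δ i x (d ω)) μ := by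
    have := (Integrable.of_bound (hm1.sub hm2).aestronglyMeasurable _ hdiff).add hi2
    exact this.congr (Eventually.of_forall fun ω => sub_add_cancel _ _)
  have hmean : meanEstimate μ p f δ d x i = ∫ ω, noiselessEstimate p f δ i x (d ω) ∂μ := rfl
  have hlin : ∫ ω, linearEstimate p f i x (d ω) ∂μ = gradient f x i :=
    scale_mul_integral_inner_mul hd hK hlaw hind (gradient f x) i
  rw [hmean, ← hlin, ← integral_sub hi1 hi2]
  have := norm_integral_le_of_norm_le_const hdiff
  rwa [probReal_univ, mul_one, Real.norm_eq_abs] at this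

theorem tendsto_meanEstimate_sub_gradient {f : Vec N → ℝ} (hf : ContDiff ℝ 2 f)
    {d : ℕ → Ω → Vec N} (hd : ∀ n, Measurable (d n)) (hK0 : 0 ≤ K)
    (hK : ∀ n, ∀ᵐ ω ∂μ, ∀ i, |d n ω i| ≤ K) (hlaw : ∀ n i, μ.map (fun ω => d n ω i) = p.law)
    (hind : ∀ n, Pairwise fun i j => IndepFun (fun ω => d n ω i) (fun ω => d n ω j) μ)
    {δ : ℕ → ℝ} (hδ_pos : ∀ n, 0 < δ n) (hδ : Tendsto δ atTop (𝓝 0))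
    {x : ℕ → Vec N} {R : ℝ} (hx : ∀ n, ‖x n‖ ≤ R) :
    Tendsto (fun n => meanEstimate μ p f (δ n) (d n) (x n) - gradient f (x n)) atTop (𝓝 0) := by
  obtain ⟨L, hL, hLip⟩ := exists_lipschitz_gradient hf (R + N * K)
  rw [tendsto_vec_iff]
  intro i
  refine squeeze_zero_norm' (a := fun n => p.scale * (L * (N * K) ^ 2 * δ n) * K) ?_ ?_
  · filter_upwards [hδ.eventually (ge_mem_nhds one_pos)] with n hn
    exact abs_meanEstimate_sub_gradient_le (hf.of_le (by norm_num)) (hd n) hK0 (hK n) (hlaw n)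
      (hind n) hL hLip (hx n) (hδ_pos n) hn i
  · simpa using ((hδ.const_mul (L * (N * K) ^ 2)).const_mul p.scale).mul_const K

end Bias

/-! ### Conditional mean and second moment of one step -/

section Step

/-- Pull out `A` on the finer σ-field, then use the tower property. It serves with `A` a multiple of
a coordinate of `d_n`, `B` the noise difference and `m'` generated by `d_n` and the past. -/
theorem condExp_mul_eq_zero {Ω : Type*} {m m' m0 : MeasurableSpace Ω} {μ : Measure Ω}
    [IsProbabilityMeasure μ] (hmm' : m ≤ m') (hm' : m' ≤ m0) {A B : Ω → ℝ}
    (hA : StronglyMeasurable[m'] A) (hAB : Integrable (A * B) μ) (hB : Integrable B μ)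
    (h0 : μ[B | m'] =ᵐ[μ] 0) : μ[A * B | m] =ᵐ[μ] 0 := by
  have h1 : μ[A * B | m'] =ᵐ[μ] 0 :=
    (condExp_mul_of_stronglyMeasurable_left hA hAB hB).trans (by
      filter_upwards [h0] with ω hω
      simp [hω])
  refine (condExp_condExp_of_le hmm' hm').symm.trans ((condExp_congr_ae h1).trans ?_)
  rw [condExp_zero]

variable {N : ℕ} {Ω : Type*} {m m0 : MeasurableSpace Ω} {μ : Measure Ω}
  {p : Perturbation} {f : Vec N → ℝ} {δ K : ℝ} {x d : Ω → Vec N} {ξp ξm : Ω → ℝ}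

theorem memLp_noiselessEstimate (hf : Continuous f) (hx : Measurable x) (hd : Measurable d)
    (hK : ∀ᵐ ω ∂μ, ∀ i, |d ω i| ≤ K)
    (hfp : MemLp (fun ω => f (x ω + δ • d ω)) 2 μ)
    (hfm : MemLp (fun ω => f (x ω - δ • d ω)) 2 μ) (i : Fin N) :
    MemLp (fun ω => noiselessEstimate p f δ i (x ω) (d ω)) 2 μ := by
  refine (hfp.sub hfm).of_le_mul (c := |p.scale / (2 * δ)| * K)
    ((measurable_noiselessEstimate p hf δ i).comp (hx.prodMk hd)).aestronglyMeasurable ?_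
  filter_upwards [hK] with ω hω
  have h1 : noiselessEstimate p f δ i (x ω) (d ω) =
      p.scale / (2 * δ) * d ω i * (f (x ω + δ • d ω) - f (x ω - δ • d ω)) := by
    rw [noiselessEstimate]; ring
  rw [h1, norm_mul, norm_mul, Real.norm_eq_abs, Real.norm_eq_abs, Pi.sub_apply]
  gcongr
  exact hω i

theorem memLp_noise (hd : Measurable d) (hK : ∀ᵐ ω ∂μ, ∀ i, |d ω i| ≤ K)
    (hξp : MemLp ξp 2 μ) (hξm : MemLp ξm 2 μ) (i : Fin N) :
    MemLp (fun ω => p.scale / (2 * δ) * d ω i * (ξp ω - ξm ω)) 2 μ := by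
  refine (hξp.sub hξm).of_le_mul (c := |p.scale / (2 * δ)| * K) ?_ ?_
  · exact AEStronglyMeasurable.mul (by fun_prop) (hξp.sub hξm).1
  filter_upwards [hK] with ω hω
  rw [norm_mul, norm_mul, Real.norm_eq_abs, Real.norm_eq_abs, Pi.sub_apply]
  gcongr
  exact hω i

theorem memLp_gradEstimate (hf : Continuous f) (hx : Measurable x) (hd : Measurable d)
    (hK : ∀ᵐ ω ∂μ, ∀ i, |d ω i| ≤ K)
    (hfp : MemLp (fun ω => f (x ω + δ • d ω)) 2 μ)
    (hfm : MemLp (fun ω => f (x ω - δ • d ω)) 2 μ)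
    (hξp : MemLp ξp 2 μ) (hξm : MemLp ξm 2 μ) (i : Fin N) :
    MemLp (fun ω => gradEstimate p f δ (x ω) (d ω) (ξp ω) (ξm ω) i) 2 μ := by
  simp_rw [gradEstimate_apply]
  exact (memLp_noiselessEstimate hf hx hd hK hfp hfm i).add (memLp_noise hd hK hξp hξm i)

theorem integral_gradEstimate_sq_le {C : ℝ} (hK : ∀ᵐ ω ∂μ, ∀ i, |d ω i| ≤ K)
    (hfp : MemLp (fun ω => f (x ω + δ • d ω)) 2 μ)
    (hfm : MemLp (fun ω => f (x ω - δ • d ω)) 2 μ)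
    (hξp : MemLp ξp 2 μ) (hξm : MemLp ξm 2 μ)
    (hfp' : ∫ ω, f (x ω + δ • d ω) ^ 2 ∂μ ≤ C) (hfm' : ∫ ω, f (x ω - δ • d ω) ^ 2 ∂μ ≤ C)
    (hξp' : ∫ ω, ξp ω ^ 2 ∂μ ≤ C) (hξm' : ∫ ω, ξm ω ^ 2 ∂μ ≤ C) (i : Fin N) :
    ∫ ω, gradEstimate p f δ (x ω) (d ω) (ξp ω) (ξm ω) i ^ 2 ∂μ ≤
      (p.scale / (2 * δ) * K) ^ 2 * (16 * C) := by
  set F : Ω → ℝ := fun ω => (p.scale / (2 * δ) * K) ^ 2 *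
    (4 * ((f (x ω + δ • d ω) ^ 2 + f (x ω - δ • d ω) ^ 2) + (ξp ω ^ 2 + ξm ω ^ 2))) with hF
  have i1 := hfp.integrable_sq.add hfm.integrable_sq
  have i2 := hξp.integrable_sq.add hξm.integrable_sq
  have hFi : Integrable F μ := ((i1.add i2).const_mul 4).const_mul _
  calc ∫ ω, gradEstimate p f δ (x ω) (d ω) (ξp ω) (ξm ω) i ^ 2 ∂μ ≤ ∫ ω, F ω ∂μ := by
        refine integral_mono_of_nonneg (Eventually.of_forall fun ω => sq_nonneg _) hFi ?_
        filter_upwards [hK] with ω hω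
        have h1 : d ω i ^ 2 ≤ K ^ 2 := sq_le_sq' (by linarith [(abs_le.1 (hω i)).1])
          (abs_le.1 (hω i)).2
        have h2 : gradEstimate p f δ (x ω) (d ω) (ξp ω) (ξm ω) i ^ 2 =
            (p.scale / (2 * δ)) ^ 2 * d ω i ^ 2 *
              (f (x ω + δ • d ω) + ξp ω - (f (x ω - δ • d ω) + ξm ω)) ^ 2 := by
          simp only [gradEstimate, PiLp.smul_apply, smul_eq_mul]
          ring
        change _ ≤ (p.scale / (2 * δ) * K) ^ 2 * (4 * _)
        rw [h2, mul_pow]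
        gcongr
        -- The square of a signed sum of four terms is at most four times the sum of their squares;
        -- with each second moment at most `C` this gives `16 * C`.
        nlinarith [sq_nonneg (f (x ω + δ • d ω) - ξp ω), sq_nonneg (f (x ω - δ • d ω) - ξm ω),
          sq_nonneg (f (x ω + δ • d ω) + ξp ω + (f (x ω - δ • d ω) + ξm ω))]
    _ ≤ (p.scale / (2 * δ) * K) ^ 2 * (16 * C) := by
        simp only [hF]
        rw [integral_const_mul, integral_const_mul,
          integral_add (f := fun ω => f (x ω + δ • d ω) ^ 2 + f (x ω - δ • d ω) ^ 2)
            (g := fun ω => ξp ω ^ 2 + ξm ω ^ 2) i1 i2,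
          integral_add hfp.integrable_sq hfm.integrable_sq,
          integral_add hξp.integrable_sq hξm.integrable_sq]
        refine mul_le_mul_of_nonneg_left ?_ (sq_nonneg _)
        linarith

/-- The noiseless part is computed by freezing `x` and averaging over the independent `d`; the
measurement noise averages to zero already given `d` and the past. -/
theorem condExp_gradEstimate [IsProbabilityMeasure μ] (hm : m ≤ m0) (hf : Continuous f) (hx : Measurable[m] x)
    (hd : Measurable d) (hK : ∀ᵐ ω ∂μ, ∀ i, |d ω i| ≤ K)
    (hind : Indep (MeasurableSpace.comap d inferInstance) m μ)
    (hnoise : μ[ξp - ξm | MeasurableSpace.comap d inferInstance ⊔ m] =ᵐ[μ] 0)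
    (hfp : MemLp (fun ω => f (x ω + δ • d ω)) 2 μ)
    (hfm : MemLp (fun ω => f (x ω - δ • d ω)) 2 μ)
    (hξp : MemLp ξp 2 μ) (hξm : MemLp ξm 2 μ) (i : Fin N) :
    μ[fun ω => gradEstimate p f δ (x ω) (d ω) (ξp ω) (ξm ω) i | m] =ᵐ[μ]
      fun ω => meanEstimate μ p f δ d (x ω) i := by
  have hx0 : Measurable x := hx.mono hm le_rfl
  have iP := (memLp_noiselessEstimate (p := p) hf hx0 hd hK hfp hfm i).integrable (by norm_num)
  have iQ := (memLp_noise (p := p) (δ := δ) hd hK hξp hξm i).integrable (by norm_num)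
  have hP := condExp_ae_eq_integral_of_indep hm hd hx hind
    (measurable_noiselessEstimate p hf δ i) iP
  have hdi : Measurable[MeasurableSpace.comap d inferInstance ⊔ m]
      fun ω => p.scale / (2 * δ) * d ω i := by
    have h1 : Measurable[MeasurableSpace.comap d inferInstance ⊔ m] d :=
      (comap_measurable d).mono le_sup_left le_rfl
    have h2 : Measurable fun v : Vec N => p.scale / (2 * δ) * v i := by fun_prop
    exact h2.comp h1
  have hQ := condExp_mul_eq_zero (m := m) le_sup_right (sup_le hd.comap_le hm)
    hdi.stronglyMeasurable iQ ((hξp.sub hξm).integrable (by norm_num)) hnoise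
  simp_rw [gradEstimate_apply]
  refine (condExp_add iP iQ m).trans ?_
  filter_upwards [hP, hQ] with ω h1 h2
  rw [Pi.add_apply, h1]
  refine (congrArg _ h2).trans ?_
  simp [meanEstimate]

end Step

theorem measurable_iterate {N : ℕ} {Ω : Type*} [MeasurableSpace Ω] {p : Perturbation}
    {f : Vec N → ℝ} (hf : Continuous f) {a δ : ℕ → ℝ} {d : ℕ → Ω → Vec N} {ξp ξm : ℕ → Ω → ℝ}
    {x₀ : Ω → Vec N} (hd : ∀ n, Measurable (d n)) (hξp : ∀ n, Measurable (ξp n))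
    (hξm : ∀ n, Measurable (ξm n)) (hx₀ : Measurable x₀) (n : ℕ) :
    Measurable (iterate p f a δ d ξp ξm x₀ n) := by
  induction n with
  | zero => exact hx₀
  | succ n ih =>
    have h1 : Measurable fun ω => f (iterate p f a δ d ξp ξm x₀ n ω + δ n • d n ω) :=
      hf.measurable.comp (ih.add ((hd n).const_smul (δ n)))
    have h2 : Measurable fun ω => f (iterate p f a δ d ξp ξm x₀ n ω - δ n • d n ω) :=
      hf.measurable.comp (ih.sub ((hd n).const_smul (δ n)))
    change Measurable fun ω => iterate p f a δ d ξp ξm x₀ n ω -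
      a n • gradEstimate p f (δ n) (iterate p f a δ d ξp ξm x₀ n ω) (d n ω) (ξp n ω) (ξm n ω)
    unfold gradEstimate
    have := hξp n
    have := hξm n
    have := hd n
    fun_prop

end RDSA

end

/-! ### Almost sure convergence of the iterates -/

theorem mainTheorem2
    {Ω : Type*} [MeasurableSpace Ω] (μ : Measure Ω) [IsProbabilityMeasure μ]
    {N : ℕ} (f : RDSA.Vec N → ℝ) (xs : RDSA.Vec N)
    -- the kind of perturbation, the random inputs and the iterates
    (p : RDSA.Perturbation) (a δ : ℕ → ℝ)
    (d : ℕ → Ω → RDSA.Vec N) (ξp ξm : ℕ → Ω → ℝ) (x₀ : Ω → RDSA.Vec N)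
    (hd : ∀ n, Measurable (d n)) (hξp : ∀ n, Measurable (ξp n)) (hξm : ∀ n, Measurable (ξm n))
    (hx₀ : Measurable x₀)
    (x : ℕ → Ω → RDSA.Vec N) (hx : x = RDSA.iterate p f a δ d ξp ξm x₀)
    -- the coordinates of the perturbations have the prescribed law
    (hlaw : ∀ n i, μ.map (fun ω => d n ω i) = p.law)
    -- the equilibrium
    (hxs : RDSA.IsAsymptoticallyStable f xs)
    -- (A1)
    (hf : ContDiff ℝ 3 f)
    (hf3 : ∃ α₀ : ℝ, ∀ i j k y, |RDSA.thirdPartial f i j k y| < α₀)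
    -- (A2)
    (hnoise : ∀ n, μ[ξp n - ξm n |
      MeasurableSpace.comap (d n) inferInstance ⊔ RDSA.history x n] =ᵐ[μ] 0)
    -- (A3)
    (hmoment : ∃ α₁ α₂ ζ : ℝ, 0 < α₁ ∧ 0 < α₂ ∧ 0 < ζ ∧ ∀ n,
      ∫⁻ ω, ENNReal.ofReal (|ξp n ω| ^ (2 + ζ)) ∂μ ≤ ENNReal.ofReal α₁ ∧
      ∫⁻ ω, ENNReal.ofReal (|ξm n ω| ^ (2 + ζ)) ∂μ ≤ ENNReal.ofReal α₁ ∧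
      ∫⁻ ω, ENNReal.ofReal (|f (x n ω + δ n • d n ω)| ^ (2 + ζ)) ∂μ ≤ ENNReal.ofReal α₂ ∧
      ∫⁻ ω, ENNReal.ofReal (|f (x n ω - δ n • d n ω)| ^ (2 + ζ)) ∂μ ≤ ENNReal.ofReal α₂)
    -- (A4)
    (hiid : iIndepFun (fun (q : ℕ × Fin N) ω => d q.1 ω q.2) μ)
    (hindep : ∀ n, Indep (MeasurableSpace.comap (d n) inferInstance) (RDSA.history x n) μ)
    -- (A5)
    (ha_pos : ∀ n, 0 < a n) (hδ_pos : ∀ n, 0 < δ n)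
    (ha : Tendsto a atTop (𝓝 0)) (hδ : Tendsto δ atTop (𝓝 0))
    (ha_sum : Tendsto (fun n => ∑ k ∈ Finset.range n, a k) atTop atTop)
    (haδ_sum : Summable fun n => (a n / δ n) ^ 2)
    -- (A6)
    (hbdd : ∀ᵐ ω ∂μ, BddAbove (Set.range fun n => ‖x n ω‖))
    -- a compact subset of the domain of attraction is visited infinitely often
    (hvisit : ∃ D : Set (RDSA.Vec N), IsCompact D ∧ D ⊆ RDSA.domainOfAttraction f xs ∧
      ∀ᵐ ω ∂μ, ∃ᶠ n in atTop, x n ω ∈ D) :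
    ∀ᵐ ω ∂μ, Tendsto (fun n => x n ω) atTop (𝓝 xs) := by
  obtain ⟨α₁, α₂, ζ, hα₁, hα₂, hζ, hmom⟩ := hmoment
  obtain ⟨K, hK0, hKlaw⟩ := p.exists_ae_abs_le
  obtain ⟨D, hD, hDsub, hDvisit⟩ := hvisit
  have hf2 : ContDiff ℝ 2 f := hf.of_le (by norm_num)
  have hfc : Continuous f := hf.continuous
  have hxm : ∀ n, Measurable (x n) := fun n => by
    rw [hx]; exact RDSA.measurable_iterate hfc hd hξp hξm hx₀ n
  have hxs_succ : ∀ n ω, x (n + 1) ω =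
      x n ω - a n • RDSA.gradEstimate p f (δ n) (x n ω) (d n ω) (ξp n ω) (ξm n ω) := fun n ω => by
    rw [hx]; rfl
  have hle : ∀ n, RDSA.history x n ≤ ‹MeasurableSpace Ω› := fun n =>
    iSup₂_le fun m _ => (hxm m).comap_le
  let ℱ : Filtration ℕ ‹MeasurableSpace Ω› :=
    ⟨RDSA.history x, fun m n hmn => biSup_mono fun k hk => hk.trans hmn, hle⟩
  have hxℱ : ∀ m n, m ≤ n → Measurable[ℱ n] (x m) := fun m n hmn =>
    (comap_measurable (x m)).mono (le_iSup₂ (f := fun k (_ : k ≤ n) =>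
      MeasurableSpace.comap (x k) inferInstance) m hmn) le_rfl
  -- boundedness and uncorrelatedness of the perturbations
  have hdi : ∀ n i, Measurable fun ω => d n ω i := fun n i => by
    have := hd n
    fun_prop
  have hK : ∀ n, ∀ᵐ ω ∂μ, ∀ i, |d n ω i| ≤ K := fun n => by
    rw [ae_all_iff]
    intro i
    rw [← hlaw n i] at hKlaw
    exact ae_of_ae_map (hdi n i).aemeasurable hKlaw
  have hpair : ∀ n, Pairwise fun i j => IndepFun (fun ω => d n ω i) (fun ω => d n ω j) μ :=
    fun n i j hij => hiid.indepFun (i := (n, i)) (j := (n, j)) (by simpa using hij)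
  -- second moments
  have hfpm : ∀ n, Measurable fun ω => f (x n ω + δ n • d n ω) := fun n =>
    hfc.measurable.comp ((hxm n).add ((hd n).const_smul (δ n)))
  have hfmm : ∀ n, Measurable fun ω => f (x n ω - δ n • d n ω) := fun n =>
    hfc.measurable.comp ((hxm n).sub ((hd n).const_smul (δ n)))
  have hξp2 := fun n => RDSA.memLp_two_and_integral_sq_le (hξp n).aestronglyMeasurable hζ hα₁
    (hmom n).1
  have hξm2 := fun n => RDSA.memLp_two_and_integral_sq_le (hξm n).aestronglyMeasurable hζ hα₁
    (hmom n).2.1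
  have hfp2 := fun n => RDSA.memLp_two_and_integral_sq_le (hfpm n).aestronglyMeasurable hζ hα₂
    (hmom n).2.2.1
  have hfm2 := fun n => RDSA.memLp_two_and_integral_sq_le (hfmm n).aestronglyMeasurable hζ hα₂
    (hmom n).2.2.2
  set C : ℝ := 1 + (α₁ + α₂) with hC
  -- the martingale noise is summable
  set g : ℕ → Fin N → Ω → ℝ := fun n i ω =>
    RDSA.gradEstimate p f (δ n) (x n ω) (d n ω) (ξp n ω) (ξm n ω) i with hg
  have hgL : ∀ n i, MemLp (g n i) 2 μ := fun n i =>
    RDSA.memLp_gradEstimate hfc (hxm n) (hd n) (hK n) (hfp2 n).1 (hfm2 n).1 (hξp2 n).1 (hξm2 n).1 i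
  have hg2 : ∀ n i, ∫ ω, g n i ω ^ 2 ∂μ ≤ (p.scale / (2 * δ n) * K) ^ 2 * (16 * C) := fun n i =>
    RDSA.integral_gradEstimate_sq_le (hK n) (hfp2 n).1 (hfm2 n).1 (hξp2 n).1 (hξm2 n).1
      (by linarith [(hfp2 n).2]) (by linarith [(hfm2 n).2]) (by linarith [(hξp2 n).2])
      (by linarith [(hξm2 n).2]) i
  -- The factor `1 / δ n ^ 2` in the second moment combines with `a n ^ 2` into the summable `(a n /
  -- δ n) ^ 2`.
  have hsum : ∀ i, Summable fun n => ∫ ω, (a n • g n i) ω ^ 2 ∂μ := fun i => by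
    refine Summable.of_nonneg_of_le (fun n => integral_nonneg fun ω => sq_nonneg _) (fun n => ?_)
      (haδ_sum.mul_right ((p.scale / 2 * K) ^ 2 * (16 * C)))
    simp only [Pi.smul_apply, smul_eq_mul, mul_pow]
    rw [integral_const_mul]
    refine (mul_le_mul_of_nonneg_left (hg2 n i) (sq_nonneg _)).trans (le_of_eq ?_)
    have := (hδ_pos n).ne'
    field_simp
  -- The filtration is generated by the iterates alone, but the scaled estimate equals `x n - x (n +
  -- 1)` and so is known at time `n + 1`.
  have hadapt : ∀ i n, StronglyMeasurable[ℱ (n + 1)] (a n • g n i) := fun i n => by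
    have h1 : a n • g n i = fun ω => x n ω i - x (n + 1) ω i := by
      ext ω
      simp [hxs_succ, hg]
    have hi : Measurable fun v : RDSA.Vec N => v i := by fun_prop
    rw [h1]
    exact ((hi.comp (hxℱ n (n + 1) n.le_succ)).sub
      (hi.comp (hxℱ (n + 1) (n + 1) le_rfl))).stronglyMeasurable
  have hmart : ∀ i, ∀ᵐ ω ∂μ, ∃ c, Tendsto (fun n => ∑ k ∈ Finset.range n,
      (a k • g k i - μ[a k • g k i | ℱ k]) ω) atTop (𝓝 c) := fun i =>
    RDSA.ae_exists_tendsto_sum_sub_condExp (hadapt i) (fun n => (hgL n i).const_smul (a n)) (hsum i)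
  have hcond : ∀ i n, μ[a n • g n i | ℱ n] =ᵐ[μ]
      fun ω => a n * RDSA.meanEstimate μ p f (δ n) (d n) (x n ω) i := fun i n => by
    refine (condExp_smul (a n) (g n i) (ℱ n)).trans ?_
    have := RDSA.condExp_gradEstimate (p := p) (hle n) hfc (hxℱ n n le_rfl) (hd n) (hK n)
      (hindep n) (hnoise n) (hfp2 n).1 (hfm2 n).1 (hξp2 n).1 (hξm2 n).1 i
    filter_upwards [this] with ω hω
    rw [Pi.smul_apply, smul_eq_mul]
    exact congrArg _ hω
  filter_upwards [hbdd, hDvisit, ae_all_iff.2 hmart, ae_all_iff.2 fun i => ae_all_iff.2 (hcond i)]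
    with ω hω hωD hωm hωc
  obtain ⟨R, hR⟩ := hω
  have hR' : ∀ n, ‖x n ω‖ ≤ R := fun n => hR ⟨n, rfl⟩
  choose S hS using hωm
  -- From here `ω` is fixed and the bound `R` may depend on it. The estimate splits into gradient,
  -- bias `b` and martingale noise `m`.
  refine RDSA.tendsto_of_convergent_noise hf2 hxs ha_pos ha ha_sum (x := fun n => x n ω)
    (b := fun n => RDSA.meanEstimate μ p f (δ n) (d n) (x n ω) - gradient f (x n ω))
    (m := fun n => RDSA.gradEstimate p f (δ n) (x n ω) (d n ω) (ξp n ω) (ξm n ω) -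
      RDSA.meanEstimate μ p f (δ n) (d n) (x n ω)) (fun n => ?_)
    (RDSA.tendsto_meanEstimate_sub_gradient hf2 hd hK0 hK hlaw hpair hδ_pos hδ hR')
    (S := WithLp.toLp 2 S) ?_ hR' hD hDsub hωD
  · rw [hxs_succ]
    congr 2
    abel
  · rw [RDSA.tendsto_vec_iff]
    intro i
    refine (hS i).congr fun n => ?_
    rw [WithLp.ofLp_sum, Finset.sum_apply]
    refine Finset.sum_congr rfl fun k _ => ?_
    rw [Pi.sub_apply, hωc i k]
    simp only [hg, Pi.smul_apply, PiLp.smul_apply, PiLp.sub_apply, smul_eq_mul]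
    ring
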